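/- **Model.** Base stations (BSs) form a homogeneous Poisson point process $\Phi$ of intensity $\lambda>0$ on $\mathbb R^2$; the typical user is at the origin. The BSs carry independent marks. The link from a BS at $y$ to the origin is LOS with probability $p_{\rm LOS}\in[0,1]$ if $\|y\|\le D$ and NLOS otherwise; its path loss in dB is $\beta+10\alpha_j\log_{10}\|y\|+S_y$ with $S_y\sim N(0,\xi_j^2)$, where $j\in\{\mathrm L,\mathrm N\}$ is its state, $\alpha_j>0$, $\xi_j\ge 0$ (with $\xi_j=0$ meaning $S_y=0$), $D\ge 0$, and $L(y)>0$ denotes the path loss in linear scale. The link has $\eta_j\ge1$ paths with i.i.d. complex normal gains $\gamma_{1},\gamma_2,\dots$ (mean $0$, variance $1$), AOAs $\phi_{1},\phi_2,\dots$ i.i.d. with law $q_{\rm UE}$ on $\{1,\dots,N_{\rm UE}\}$ and AODs $\theta_{1},\theta_2,\dots$ i.i.d. with law $q_{\rm BS}$ on $\{1,\dots,N_{\rm BS}\}$. The BS at $y$ serves $U_y$ users, where $U_y$ has law $\tilde p$ on $\{0,1,2,\dots\}$, through beams with directions $\theta_{y,w}$, $w\le U_y$, i.i.d. with law $q_{\rm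 BS}$. The user is served by the BS $x$ of minimum path loss, and its combiner points at the AOA $\phi_0\sim q_{\rm UE}$ of the service link; apart from the dependence of the link state, the shadowing and the path loss on position and state just described, all these variables are independent, and $\phi_0$ is independent of the marked process. Fix $\rho_{\rm BS},\rho_{\rm UE}\in[0,1)$, transmit power $P>0$, and $G=P N_{\rm BS}N_{\rm UE}$. Let $\chi_{j,w}=a_j b_{j,w}$ with $a_j=1$ if $\phi_j=\phi_0$ and $a_j=\rho_{\rm UE}$ otherwise, $b_{j,w}=1$ if $\theta_j=\theta_{y,w}$ and $b_{j,w}=\rho_{\rm BS}$ otherwise. The out-of-cell interference is $$I_0=\sum_{y\in\Phi,\,y\ne x}I_{y,0},\qquad I_{y,0}=\frac{G}{L(y)\,\eta_y U_y}\sum_{w=1}^{U_y}\Big|\sum_{j=1}^{\eta_y}\gamma_j\chi_{j,w}\Big|^2 ,$$ where $\eta_y$ is the number of paths of the link of $y$, and $I_{y,0}=0$ if $U_y=0$. Put $L_{I_0,l}(s)=\mathbb E[e^{-sI_0}\mid L(x)=l]$, let $\Lambda_{\rm L},\Lambda_{\rm N}$ be the intensity measures on $(0,\infty)$ of the processes $\{L(y)\}$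 of path losses of the LOS and of the NLOS BSs, and $\Lambda=\Lambda_{\rm L}+\Lambda_{\rm N}$. We use $e^{-\infty}=0$, $1/0=\infty$, $1/\infty=0$ and $0\cdot\infty=0$. **Claim.** Let $s\ge 0$. For almost every $l$ with respect to the law of $L(x)$: 1. (Upper bound) $$L_{I_0,l}(s)\le\exp\Big(-(1-\tilde p(0))\int_l^\infty\frac{\Lambda(dt)}{1+(sGt^{-1}\rho_{\rm BS}^2\rho_{\rm UE}^2)^{-1}}\Big);$$ in particular, if $\tilde p(0)=0$ (every interfering BS serves at least one user), $$L_{I_0,l}(s)\le\exp\Big(-\int_l^\infty\frac{\Lambda(dt)}{1+(sGt^{-1}\rho_{\rm BS}^2\rho_{\rm UE}^2)^{-1}}\Big).$$ 2. (Lower bound) $$L_{I_0,l}(s)\ge\exp\Big(-\int_l^\infty(1-\mathbb E[\Psi_{t,\rm L}])\Lambda_{\rm L}(dt)\Big)\exp\Big(-\int_l^\infty(1-\mathbb E[\Psi_{t,\rm N}])\Lambda_{\rm N}(dt)\Big),$$ where $\Psi_{t,j}=\Psi_t(\eta_j,U)$, the expectation is over $U\sim\tilde p$, and $\Psi_t(\eta,U)$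 may be taken to be either of the following: (a) the expectation over the virtual angles $\mathbb E\big[(1+\frac{sGt^{-1}}{\eta U}\sum_{w=1}^{U}\sum_{j=1}^{\eta}\chi_{j,w}^2)^{-\eta}\big]$; (b) the explicit sum $$\Psi_t(\eta,U)=\sum_{i=1}^{N_{\rm UE}}\sum_{m=0}^{\eta}\binom{\eta}{m}q_{{\rm UE},i}^{m+1}(1-q_{{\rm UE},i})^{\eta-m}\sum_{k_1,\dots,k_U=1}^{N_{\rm BS}}\ \sum_{j_1,\dots,j_U=0}^{\eta}\ \prod_{n=1}^{U}\binom{\eta}{j_n}q_{{\rm BS},k_n}^{j_n+1}(1-q_{{\rm BS},k_n})^{\eta-j_n}$$ $$\times\Big(1+\frac{sGt^{-1}}{\eta U}\sum_{r=1}^{\eta}\Big(\sum_{n=1}^{U}\big(\rho_{\rm BS}^2+\mathbf 1(r\le j_n)(1-\rho_{\rm BS}^2)\big)\Big)\big(\rho_{\rm UE}^2+\mathbf 1(r\le m)(1-\rho_{\rm UE}^2)\big)\Big)^{-\eta}.$$ In both, $\Psi_t(\eta,0)=1$. 3. If $q_{\rm UE}$ and $q_{\rm BS}$ are uniform, the sum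 in (b) equals, for all $\eta,U,t$, $$\sum_{m=0}^{\eta}\binom{\eta}{m}\Big(\frac1{N_{\rm UE}}\Big)^{m}\Big(1-\frac1{N_{\rm UE}}\Big)^{\eta-m}\sum_{j_1,\dots,j_U=0}^{\eta}\ \prod_{n=1}^{U}\binom{\eta}{j_n}\Big(\frac1{N_{\rm BS}}\Big)^{j_n}\Big(1-\frac1{N_{\rm BS}}\Big)^{\eta-j_n}$$ $$\times\Big(1+\frac{sGt^{-1}}{\eta U}\sum_{r=1}^{\eta}\Big(\sum_{n=1}^{U}\big(\rho_{\rm BS}^2+\mathbf 1(r\le j_n)(1-\rho_{\rm BS}^2)\big)\Big)\big(\rho_{\rm UE}^2+\mathbf 1(r\le m)(1-\rho_{\rm UE}^2)\big)\Big)^{-\eta}$$ (the fraction $\frac{sGt^{-1}}{\eta U}$ being read as $0$ if $\eta U=0$ or $t=0$). -/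

import Mathlib

open MeasureTheory ProbabilityTheory
open scoped ENNReal NNReal

noncomputable section

namespace MmWave

/-- `e^{-x}` for `x ∈ [0,∞]`, with `e^{-∞} = 0`. -/
def expNeg (x : ℝ≥0∞) : ℝ≥0∞ := EReal.exp (-(x : EReal))

/-- Deterministic parameters of the network. Quantities that depend on the state of a link are
indexed by `Bool`, where `true` means LOS and `false` means NLOS. -/
structure Params (NBS NUE : ℕ) where
  /-- BS density -/
  lam : ℝ
  /-- reference path loss (dB) at one metre -/
  beta : ℝ
  /-- path loss exponents -/
  alpha : Bool → ℝ
  /-- shadowing standard deviations (dB) -/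
  xi : Bool → ℝ≥0
  /-- LOS probability of a link of length at most `D` -/
  pLOS : ℝ
  /-- LOS radius -/
  D : ℝ
  /-- number of paths of a link -/
  eta : Bool → ℕ
  /-- transmit power -/
  power : ℝ
  /-- sidelobe parameter at the BSs -/
  rhoBS : ℝ
  /-- sidelobe parameter at the users -/
  rhoUE : ℝ
  /-- distribution of a quantized virtual AOD -/
  qBS : PMF (Fin NBS)
  /-- distribution of a quantized virtual AOA -/
  qUE : PMF (Fin NUE)
  /-- distribution of the number of users scheduled by an interfering BS -/
  pU : PMF ℕ
  lam_pos : 0 < lam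
  alpha_pos : ∀ b, 0 < alpha b
  pLOS_nonneg : 0 ≤ pLOS
  pLOS_le_one : pLOS ≤ 1
  D_nonneg : 0 ≤ D
  eta_pos : ∀ b, 1 ≤ eta b
  power_pos : 0 < power
  rhoBS_nonneg : 0 ≤ rhoBS
  rhoBS_lt_one : rhoBS < 1
  rhoUE_nonneg : 0 ≤ rhoUE
  rhoUE_lt_one : rhoUE < 1

/-- The location and the link state of a BS: position, LOS/NLOS indicator, shadowing (dB). -/
abbrev Link : Type := EuclideanSpace ℝ (Fin 2) × Bool × ℝ

/-- The virtual angles of an interfering BS: the AOA and the AOD of each path of its channel to the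
typical user, and the direction of the beam serving each of its own users. -/
abbrev Angles (NBS NUE : ℕ) : Type := (ℕ → Fin NUE) × (ℕ → Fin NBS) × (ℕ → Fin NBS)

/-- A BS together with its marks: its link, the number of users that it serves, the small scale
fading of each path, and the virtual angles. Only the first `η` paths and the first `U` beams of
the sequences are used. -/
abbrev Station (NBS NUE : ℕ) : Type := Link × ℕ × (ℕ → ℂ) × Angles NBS NUE

variable {NBS NUE : ℕ}

/-- Path loss in dB to the origin. -/
def pathLossDB (c : Params NBS NUE) (y : Link) : ℝ :=
  c.beta + 10 * c.alpha y.2.1 * Real.logb 10 ‖y.1‖ + y.2.2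

/-- Path loss to the origin in linear scale. -/
def pathLoss (c : Params NBS NUE) (y : Link) : ℝ := (10 : ℝ) ^ (pathLossDB c y / 10)

/-- The array gain `G = P · N_BS · N_UE`. -/
def gain (c : Params NBS NUE) : ℝ := c.power * NBS * NUE

/-- The probability that a link from position `x` to the origin is in state `b`. -/
def stateProb (c : Params NBS NUE) (b : Bool) (x : EuclideanSpace ℝ (Fin 2)) : ℝ≥0∞ :=
  if ‖x‖ ≤ c.D then ENNReal.ofReal (if b then c.pLOS else 1 - c.pLOS)
  else (if b then 0 else 1)

/-- Intensity of the BSs in link state `b`, marked with their state and their shadowing. -/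
def linkIntensity (c : Params NBS NUE) (b : Bool) : Measure Link :=
  ((ENNReal.ofReal c.lam • (volume : Measure (EuclideanSpace ℝ (Fin 2)))).withDensity
    (stateProb c b)).prod ((Measure.dirac b).prod (gaussianReal 0 (c.xi b ^ 2)))

/-- The intensity measure `Λ_L` (`b = true`) or `Λ_N` (`b = false`) of the propagation process
`𝒩_L`, respectively `𝒩_N`, of path losses. -/
def lossIntensity (c : Params NBS NUE) (b : Bool) : Measure ℝ :=
  (linkIntensity c b).map (pathLoss c)

/-- The circularly symmetric complex normal law with zero mean and unit variance. -/
def complexNormal : Measure ℂ :=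
  ((gaussianReal 0 (1 / 2)).prod (gaussianReal 0 (1 / 2))).map (fun z : ℝ × ℝ => (⟨z.1, z.2⟩ : ℂ))

/-- All virtual angles are independent. -/
def anglesLaw (c : Params NBS NUE) : Measure (Angles NBS NUE) :=
  (Measure.infinitePi fun _ : ℕ => c.qUE.toMeasure).prod
    ((Measure.infinitePi fun _ : ℕ => c.qBS.toMeasure).prod
      (Measure.infinitePi fun _ : ℕ => c.qBS.toMeasure))

/-- The intensity measure of the independently marked homogeneous Poisson process of BSs. -/
def stationIntensity (c : Params NBS NUE) : Measure (Station NBS NUE) :=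
  (linkIntensity c true + linkIntensity c false).prod
    (c.pU.toMeasure.prod
      ((Measure.infinitePi fun _ : ℕ => complexNormal).prod (anglesLaw c)))

/-- The number of points of the configuration `S` in `A`. -/
def count {E : Type*} (S A : Set E) : ℕ∞ := (S ∩ A).encard

/-- The random set `Φ` is a (simple) Poisson point process with intensity measure `Λ`. -/
structure IsPoissonProcess {Ω E : Type*} [MeasurableSpace Ω] [MeasurableSpace E]
    (P : Measure Ω) (Φ : Ω → Set E) (Λ : Measure E) : Prop where
  measurable_count : ∀ A, MeasurableSet A → Measurable fun ω => count (Φ ω) A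
  law_count : ∀ A, MeasurableSet A → Λ A ≠ ∞ →
    P.map (fun ω => count (Φ ω) A) =
      (poissonMeasure (Λ A).toNNReal).map (fun n : ℕ => (n : ℕ∞))
  indep_count : ∀ (n : ℕ) (A : Fin n → Set E), (∀ i, MeasurableSet (A i)) →
    Pairwise (fun i j => Disjoint (A i) (A j)) →
    iIndepFun (fun i ω => count (Φ ω) (A i)) P

/-- The sigma-algebra on the sample space generated by a point process. -/
abbrev processSigma {Ω E : Type*} [MeasurableSpace E] (Φ : Ω → Set E) : MeasurableSpace Ω :=
  ⨆ A : {A : Set E // MeasurableSet A},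
    MeasurableSpace.comap (fun ω => count (Φ ω) A.1) inferInstance

/-- The random objects of the model: the marked Poisson process `Φ` of BSs, and the AOA `φ₀`
(virtual angle) of the service link, at which the typical user points its combiner. -/
structure IsNetwork {Ω : Type*} [MeasurableSpace Ω] (P : Measure Ω) (c : Params NBS NUE)
    (Φ : Ω → Set (Station NBS NUE)) (φ₀ : Ω → Fin NUE) : Prop where
  poisson : IsPoissonProcess P Φ (stationIntensity c)
  measurable_aoa : Measurable φ₀
  law_aoa : P.map φ₀ = c.qUE.toMeasure
  indep : Indep (processSigma Φ) (MeasurableSpace.comap φ₀ inferInstance) P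

/-- Inner product of two beam steering vectors with sidelobe parameter `ρ`. -/
def beamInner {n : ℕ} (ρ : ℝ) (θ₁ θ₂ : Fin n) : ℝ := if θ₁ = θ₂ then 1 else ρ

/-- `χ_{j,w}`: the gain of path `j` against the beam serving user `w`. -/
def chi (c : Params NBS NUE) (φ₀ : Fin NUE) (a : Angles NBS NUE) (j w : ℕ) : ℝ :=
  beamInner c.rhoUE φ₀ (a.1 j) * beamInner c.rhoBS (a.2.1 j) (a.2.2 w)

/-- The interference power `I_{y,0} = G / (L η U) · ∑_w |∑_j γ_j χ_{j,w}|²` received at the origin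
from the BS `y`; it is `0` if the BS serves nobody. -/
def power (c : Params NBS NUE) (φ₀ : Fin NUE) (y : Station NBS NUE) : ℝ :=
  gain c / (pathLoss c y.1 * c.eta y.1.2.1 * y.2.1) *
    ∑ w ∈ Finset.range y.2.1,
      ‖∑ j ∈ Finset.range (c.eta y.1.2.1), y.2.2.1 j * (chi c φ₀ y.2.2.2 j w : ℂ)‖ ^ 2

/-- `x` is a BS of the configuration `S` with minimum path loss to the origin. -/
def IsServing (c : Params NBS NUE) (S : Set (Station NBS NUE)) (x : Station NBS NUE) : Prop :=
  x ∈ S ∧ ∀ y ∈ S, pathLoss c x.1 ≤ pathLoss c y.1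

open Classical in
/-- The BS serving the typical user at the origin: the one with minimum path loss (it exists and is
unique almost surely). If no BS attains the minimum, the value is `none`. -/
def servingBS (c : Params NBS NUE) (S : Set (Station NBS NUE)) : Option (Station NBS NUE) :=
  if h : ∃ x, IsServing c S x then some h.choose else none

/-- The path loss on the service link. -/
def servingLoss (c : Params NBS NUE) (S : Set (Station NBS NUE)) : ℝ :=
  match servingBS c S with
  | some x => pathLoss c x.1
  | none => 0

/-- The total out-of-cell interference power `I₀ = ∑_{y ∈ Φ, y ≠ x} I_{y,0}` at the origin. -/
def interference (c : Params NBS NUE) (S : Set (Station NBS NUE)) (φ₀ : Fin NUE) : ℝ≥0∞ :=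
  ∑' y : {y : Station NBS NUE // y ∈ S ∧ some y ≠ servingBS c S}, ENNReal.ofReal (power c φ₀ y.1)

/-- The conditional Laplace functional `L_{I₀,l}(s) = E[exp(-s I₀) | L(x,0) = l]`, through the
regular conditional distribution of `I₀` given the path loss on the service link. -/
def condLaplace {Ω : Type*} [MeasurableSpace Ω] (P : Measure Ω) [IsFiniteMeasure P]
    (c : Params NBS NUE) (Φ : Ω → Set (Station NBS NUE)) (φ₀ : Ω → Fin NUE) (s l : ℝ) : ℝ≥0∞ :=
  ∫⁻ i, expNeg (ENNReal.ofReal s * i)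
    ∂(condDistrib (fun ω => interference c (Φ ω) (φ₀ ω)) (fun ω => servingLoss c (Φ ω)) P l)

/-- `∫_l^∞ Λ(dt) / (1 + (s G t⁻¹ ρ_BS² ρ_UE²)⁻¹)` with `Λ = Λ_L + Λ_N`. -/
def upperExponent (c : Params NBS NUE) (s l : ℝ) : ℝ≥0∞ :=
  ∫⁻ t in Set.Ici l,
    1 / (1 + (ENNReal.ofReal (s * gain c * t⁻¹ * c.rhoBS ^ 2 * c.rhoUE ^ 2))⁻¹)
    ∂(lossIntensity c true + lossIntensity c false)

/-- The explicit combinatorial sum `Ψ_t`, for links with `η` paths and `U` scheduled users. -/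
def Psi (c : Params NBS NUE) (s : ℝ) (η U : ℕ) (t : ℝ) : ℝ :=
  ∑ i : Fin NUE, ∑ m ∈ Finset.range (η + 1),
    (η.choose m : ℝ) * (c.qUE i).toReal ^ (m + 1) * (1 - (c.qUE i).toReal) ^ (η - m) *
    ∑ k : Fin U → Fin NBS, ∑ j : Fin U → Fin (η + 1),
      (∏ n : Fin U, (η.choose (j n) : ℝ) * (c.qBS (k n)).toReal ^ ((j n : ℕ) + 1) *
        (1 - (c.qBS (k n)).toReal) ^ (η - (j n : ℕ))) *
      ((1 + s * gain c * t⁻¹ / (η * U) * ∑ r ∈ Finset.Icc 1 η,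
        (∑ n : Fin U, (c.rhoBS ^ 2 + if r ≤ (j n : ℕ) then 1 - c.rhoBS ^ 2 else 0)) *
        (c.rhoUE ^ 2 + if r ≤ m then 1 - c.rhoUE ^ 2 else 0)) ^ η)⁻¹

/-- The simplified form of `Ψ_t` for equiprobable virtual angles. -/
def PsiUniform (c : Params NBS NUE) (s : ℝ) (η U : ℕ) (t : ℝ) : ℝ :=
  ∑ m ∈ Finset.range (η + 1),
    (η.choose m : ℝ) * (1 / (NUE : ℝ)) ^ m * (1 - 1 / (NUE : ℝ)) ^ (η - m) *
    ∑ j : Fin U → Fin (η + 1),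
      (∏ n : Fin U, (η.choose (j n) : ℝ) * (1 / (NBS : ℝ)) ^ (j n : ℕ) *
        (1 - 1 / (NBS : ℝ)) ^ (η - (j n : ℕ))) *
      ((1 + s * gain c * t⁻¹ / (η * U) * ∑ r ∈ Finset.Icc 1 η,
        (∑ n : Fin U, (c.rhoBS ^ 2 + if r ≤ (j n : ℕ) then 1 - c.rhoBS ^ 2 else 0)) *
        (c.rhoUE ^ 2 + if r ≤ m then 1 - c.rhoUE ^ 2 else 0)) ^ η)⁻¹

/-- The expectation over the virtual angles of
`(1 + s G t⁻¹ / (η U) · ∑_w ∑_j χ_{j,w}²)^{-η}`. -/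
def PsiCS (c : Params NBS NUE) (s : ℝ) (η U : ℕ) (t : ℝ) : ℝ :=
  ∫ z, ((1 + s * gain c * t⁻¹ / (η * U) *
      ∑ w ∈ Finset.range U, ∑ j ∈ Finset.range η, chi c z.1 z.2 j w ^ 2) ^ η)⁻¹
    ∂(c.qUE.toMeasure.prod (anglesLaw c))

/-- `∫_l^∞ (1 - E[Ψ_t]) Λ_b(dt)`, the expectation being over the number of scheduled users. -/
def lowerExponent (c : Params NBS NUE) (Ψ : ℕ → ℕ → ℝ → ℝ) (b : Bool) (l : ℝ) : ℝ≥0∞ :=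
  ∫⁻ t in Set.Ici l,
    ENNReal.ofReal (1 - ∑' u : ℕ, (c.pU u).toReal * Ψ (c.eta b) u t) ∂(lossIntensity c b)

end MmWave

end

/-!
Conditionally on the point `x` of minimum path loss `l`, the points with path loss beyond `l` are
again a Poisson process, and there are no ties. Averaging over the AOA `i` of the service link gives
`L_{I₀,l}(s) = ∑ i, q_UE i * exp (-∫_{t > l} E[1 - e^{-s I_t}] dΛ)`, where `I_t` is the interference
of a BS at path loss `t`.

For the upper bound, the beams of a BS share its fading; by Jensen's inequality the Laplace
transform of their mean power is at most the mean of their Laplace transforms, and each of these is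
that of an exponential variable of mean at least `ρ_BS² ρ_UE²`.

For the lower bound, Jensen's inequality moves the average over `i` into the exponent, and
Cauchy–Schwarz bounds `|∑ γ_j χ_j|²` by `∑ χ_j² ∑ |γ_j|²`, whose second factor is common to all
beams and has the Laplace transform `(1 + v)^{-η}`.

In the explicit sum each beam of a BS is aligned with its own independent number of AODs, and the
aligned paths come first. Since `x ↦ (1 + C x)^{-η}` is a mixture of exponentials, only Laplace
transforms have to be compared. Placing the aligned AOAs and AODs on the same paths increases
`∑ χ_j²`, and making the beams independent replaces `E[Y^U]` by `(E Y)^U`; both changes decrease the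
transform.
-/

noncomputable section

namespace MmWave

open Filter Topology

section ExpNeg

lemma expNeg_zero : expNeg 0 = 1 := by simp [expNeg]

lemma expNeg_top : expNeg ∞ = 0 := by simp [expNeg]

lemma expNeg_antitone : Antitone expNeg := fun _ _ h =>
  EReal.exp_monotone (EReal.neg_le_neg_iff.2 (EReal.coe_ennreal_le_coe_ennreal_iff.2 h))

lemma expNeg_le_one (x : ℝ≥0∞) : expNeg x ≤ 1 :=
  expNeg_zero ▸ expNeg_antitone (zero_le (a := x))

lemma expNeg_ne_top (x : ℝ≥0∞) : expNeg x ≠ ∞ :=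
  ((expNeg_le_one x).trans_lt ENNReal.one_lt_top).ne

lemma continuous_expNeg : Continuous expNeg :=
  ENNReal.continuous_exp.comp (continuous_neg.comp continuous_coe_ennreal_ereal)

@[fun_prop]
lemma measurable_expNeg : Measurable expNeg := continuous_expNeg.measurable

lemma expNeg_coe (x : ℝ≥0) : expNeg x = ENNReal.ofReal (Real.exp (-x)) := by
  have h_neg : -((x : ℝ≥0∞) : EReal) = ((-(x : ℝ) : ℝ) : EReal) := by
    rw [EReal.coe_neg]; rfl
  rw [expNeg, h_neg, EReal.exp_coe]

lemma expNeg_ofReal {x : ℝ} (hx : 0 ≤ x) :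
    expNeg (ENNReal.ofReal x) = ENNReal.ofReal (Real.exp (-x)) := by
  rw [ENNReal.ofReal, expNeg_coe, Real.coe_toNNReal x hx]

lemma expNeg_add (x y : ℝ≥0∞) : expNeg (x + y) = expNeg x * expNeg y := by
  induction x with
  | top => simp [expNeg_top]
  | coe x =>
    induction y with
    | top => simp [expNeg_top]
    | coe y =>
      rw [← ENNReal.coe_add, expNeg_coe, expNeg_coe, expNeg_coe,
        ← ENNReal.ofReal_mul (Real.exp_pos _).le, ← Real.exp_add, NNReal.coe_add, neg_add]

lemma expNeg_sum {ι : Type*} (t : Finset ι) (f : ι → ℝ≥0∞) :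
    expNeg (∑ i ∈ t, f i) = ∏ i ∈ t, expNeg (f i) := by
  classical
  induction t using Finset.induction_on with
  | empty => simp [expNeg_zero]
  | insert i t hi ih => rw [Finset.sum_insert hi, Finset.prod_insert hi, expNeg_add, ih]

lemma expNeg_nat_mul (n : ℕ) (x : ℝ≥0∞) : expNeg (n * x) = expNeg x ^ n := by
  simpa using expNeg_sum (Finset.range n) fun _ => x

end ExpNeg

section PointMeasure

variable {E Ω : Type*} [MeasurableSpace E] {mΩ : MeasurableSpace Ω}

/-- The counting measure of a configuration of points, so that sums over the configuration are
integrals. -/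
def pointMeasure (S : Set E) : Measure E := Measure.sum fun y : S => Measure.dirac (y : E)

lemma lintegral_pointMeasure (S : Set E) {f : E → ℝ≥0∞} (hf : Measurable f) :
    ∫⁻ y, f y ∂(pointMeasure S) = ∑' y : S, f y := by
  rw [pointMeasure, lintegral_sum_measure]
  exact tsum_congr fun y => lintegral_dirac' _ hf

lemma pointMeasure_apply (S : Set E) {A : Set E} (hA : MeasurableSet A) :
    pointMeasure S A = (count S A : ℕ∞) := by
  rw [← lintegral_indicator_one hA, lintegral_pointMeasure S (measurable_one.indicator hA),
    tsum_subtype S, Set.indicator_indicator, ← tsum_subtype, count]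
  exact ENNReal.tsum_set_one _

lemma measurable_pointMeasure {Φ : Ω → Set E}
    (hΦ : ∀ A, MeasurableSet A → Measurable fun ω => count (Φ ω) A) :
    Measurable fun ω => pointMeasure (Φ ω) := by
  refine Measure.measurable_of_measurable_coe _ fun A hA => ?_
  simp_rw [pointMeasure_apply _ hA]
  exact (measurable_from_top (f := fun n : ℕ∞ => (n : ℝ≥0∞))).comp (hΦ A hA)

end PointMeasure

section PoissonLaplace

variable {E Ω : Type*} [MeasurableSpace E] [MeasurableSpace Ω]

lemma lintegral_pow_poissonMeasure (r : ℝ≥0) {p : ℝ} (hp : 0 ≤ p) :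
    ∫⁻ n : ℕ, ENNReal.ofReal p ^ n ∂(poissonMeasure r) =
      ENNReal.ofReal (Real.exp (-(r * (1 - p)))) := by
  have h_sum : HasSum (fun n : ℕ => p ^ n * (Real.exp (-r) * (r : ℝ) ^ n / n.factorial))
      (Real.exp (-(r * (1 - p)))) := by
    have h_exp := (NormedSpace.expSeries_div_hasSum_exp (p * r : ℝ)).mul_left (Real.exp (-r))
    rw [← Real.exp_eq_exp_ℝ, ← Real.exp_add, show -(r : ℝ) + p * r = -(r * (1 - p)) by ring]
      at h_exp
    exact h_exp.congr_fun fun n => by rw [mul_pow]; ring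
  rw [lintegral_countable', ← h_sum.tsum_eq,
    ENNReal.ofReal_tsum_of_nonneg (fun n => by positivity) h_sum.summable]
  refine tsum_congr fun n => ?_
  rw [poissonMeasure_singleton, ENNReal.ofReal_mul (by positivity), ENNReal.ofReal_pow hp]

lemma lintegral_expNeg_poissonMeasure (r : ℝ≥0) (x : ℝ≥0∞) :
    ∫⁻ n : ℕ, expNeg (x * n) ∂(poissonMeasure r) = expNeg ((1 - expNeg x) * r) := by
  set p := (expNeg x).toReal
  have hp : expNeg x = ENNReal.ofReal p := (ENNReal.ofReal_toReal (expNeg_ne_top x)).symm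
  have hp1 : p ≤ 1 := ENNReal.toReal_le_of_le_ofReal zero_le_one (by simpa using expNeg_le_one x)
  have h_exponent : (1 - expNeg x) * r = ENNReal.ofReal (r * (1 - p)) := by
    rw [hp, mul_comm, ENNReal.ofReal_mul r.coe_nonneg, ENNReal.ofReal_sub _ ENNReal.toReal_nonneg,
      ENNReal.ofReal_one, ENNReal.ofReal_coe_nnreal]
  simp_rw [mul_comm x, expNeg_nat_mul]
  rw [h_exponent, expNeg_ofReal (mul_nonneg r.coe_nonneg (sub_nonneg.2 hp1)), hp,
    lintegral_pow_poissonMeasure r ENNReal.toReal_nonneg]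

/-- Under the finite measure `Q`, the random measure `N` has the Laplace functional of a Poisson
process of intensity `Λ`. Since `Q` need not have mass one, this also covers the restriction of the
probability to an event independent of `N`. -/
def HasPoissonLaplace (Q : Measure Ω) (N : Ω → Measure E) (Λ : Measure E) : Prop :=
  ∀ g : E → ℝ≥0∞, Measurable g →
    ∫⁻ ω, expNeg (∫⁻ y, g y ∂N ω) ∂Q = Q Set.univ * expNeg (∫⁻ y, 1 - expNeg (g y) ∂Λ)

lemma exists_monotone_finMeasSupp_tendsto (Λ : Measure E) [SigmaFinite Λ] {f : E → ℝ≥0∞}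
    (hf : Measurable f) : ∃ g : ℕ → SimpleFunc E ℝ≥0∞, (∀ n, (g n).FinMeasSupp Λ) ∧
      (∀ y, Monotone fun n => g n y) ∧ ∀ y, Tendsto (fun n => g n y) atTop (𝓝 (f y)) := by
  let g n := (SimpleFunc.eapprox f n).restrict (spanningSets Λ n)
  have hg n y : g n y = (spanningSets Λ n).indicator (SimpleFunc.eapprox f n) y :=
    SimpleFunc.restrict_apply _ (measurableSet_spanningSets Λ n) y
  refine ⟨g, fun n => ?_, fun y n m hnm => ?_, fun y => ?_⟩
  · refine SimpleFunc.finMeasSupp_iff_support.2 ((measure_mono fun y hy => ?_).trans_lt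
      (measure_spanningSets_lt_top Λ n))
    rw [Function.mem_support, hg] at hy
    exact Set.mem_of_indicator_ne_zero hy
  · simp only [hg]
    exact (Set.indicator_le_indicator_of_subset (monotone_spanningSets Λ hnm)
      (fun _ => zero_le) y).trans (Set.indicator_le_indicator (SimpleFunc.monotone_eapprox f hnm y))
  · refine (SimpleFunc.tendsto_eapprox hf y).congr' ?_
    filter_upwards [eventually_ge_atTop (spanningSetsIndex Λ y)] with n hn
    rw [hg, Set.indicator_of_mem (mem_spanningSets_of_index_le Λ y hn)]

lemma tendsto_lintegral_one_sub_expNeg {Λ : Measure E} {g : ℕ → E → ℝ≥0∞} {f : E → ℝ≥0∞}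
    (hg : ∀ n, Measurable (g n)) (h_mono : ∀ y, Monotone fun n => g n y)
    (h_lim : ∀ y, Tendsto (fun n => g n y) atTop (𝓝 (f y))) :
    Tendsto (fun n => ∫⁻ y, 1 - expNeg (g n y) ∂Λ) atTop (𝓝 (∫⁻ y, 1 - expNeg (f y) ∂Λ)) := by
  refine lintegral_tendsto_of_tendsto_of_monotone (fun n => by fun_prop)
    (Eventually.of_forall fun y n m hnm => ?_) (Eventually.of_forall fun y => ?_)
  · exact tsub_le_tsub_left (expNeg_antitone (h_mono y hnm)) _
  · exact ENNReal.Tendsto.sub tendsto_const_nhds ((continuous_expNeg.tendsto _).comp (h_lim y))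
      (Or.inl ENNReal.one_ne_top)

namespace IsPoissonProcess

variable {P : Measure Ω} {Φ : Ω → Set E} {Λ : Measure E}

lemma lintegral_expNeg_count (h : IsPoissonProcess P Φ Λ) {A : Set E} (hA : MeasurableSet A)
    (h_fin : Λ A ≠ ∞) (x : ℝ≥0∞) :
    ∫⁻ ω, expNeg (x * (count (Φ ω) A : ℕ∞)) ∂P = expNeg ((1 - expNeg x) * Λ A) := by
  rw [← lintegral_map (f := fun n : ℕ∞ => expNeg (x * (n : ℝ≥0∞))) measurable_from_top
      (h.measurable_count A hA), h.law_count A hA h_fin,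
    lintegral_map measurable_from_top measurable_from_top]
  simp only [ENat.toENNReal_coe]
  rw [lintegral_expNeg_poissonMeasure, ENNReal.coe_toNNReal h_fin]

lemma iIndepFun_count_fiber (h : IsPoissonProcess P Φ Λ) {α : Type*} (f : SimpleFunc E α) :
    iIndepFun (fun (x : f.range) ω => count (Φ ω) (f ⁻¹' {(x : α)})) P := by
  let e := Fintype.equivFin f.range
  have h_indep := h.indep_count _ (fun i => f ⁻¹' {((e.symm i : f.range) : α)})
    (fun i => f.measurableSet_fiber _) fun i j hij => Disjoint.preimage _
      (Set.disjoint_singleton.2 fun hx => hij (e.symm.injective (Subtype.ext hx)))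
  simpa only [Function.comp_def, Equiv.symm_apply_apply] using h_indep.precomp e.injective

lemma isProbabilityMeasure (h : IsPoissonProcess P Φ Λ) : IsProbabilityMeasure P :=
  (h.indep_count 0 (fun _ => ∅) (fun _ => MeasurableSet.empty)
    fun i => i.elim0).isProbabilityMeasure

lemma lintegral_expNeg_simpleFunc (h : IsPoissonProcess P Φ Λ)
    {f : SimpleFunc E ℝ≥0∞} (hf : f.FinMeasSupp Λ) :
    ∫⁻ ω, expNeg (∫⁻ y, f y ∂(pointMeasure (Φ ω))) ∂P =
      expNeg (∫⁻ y, 1 - expNeg (f y) ∂Λ) := by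
  have := h.isProbabilityMeasure
  calc ∫⁻ ω, expNeg (∫⁻ y, f y ∂(pointMeasure (Φ ω))) ∂P
      = ∫⁻ ω, ∏ x : f.range, expNeg ((x : ℝ≥0∞) * (count (Φ ω) (f ⁻¹' {(x : ℝ≥0∞)}) : ℕ∞)) ∂P := by
        refine lintegral_congr fun ω => ?_
        rw [← expNeg_sum, SimpleFunc.lintegral_eq_lintegral, SimpleFunc.lintegral,
          ← Finset.sum_coe_sort f.range]
        simp_rw [pointMeasure_apply _ (f.measurableSet_fiber _)]
    _ = ∏ x : f.range,
          ∫⁻ ω, expNeg ((x : ℝ≥0∞) * (count (Φ ω) (f ⁻¹' {(x : ℝ≥0∞)}) : ℕ∞)) ∂P :=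
        lintegral_prod_eq_prod_lintegral_of_indepFun Finset.univ
          (fun (x : f.range) ω => expNeg ((x : ℝ≥0∞) * (count (Φ ω) (f ⁻¹' {(x : ℝ≥0∞)}) : ℕ∞)))
          ((h.iIndepFun_count_fiber f).comp (fun x n => expNeg ((x : ℝ≥0∞) * (n : ℕ∞)))
            fun x => measurable_from_top)
          fun x => (measurable_from_top (f := fun n : ℕ∞ => expNeg (x * (n : ℝ≥0∞)))).comp
            (h.measurable_count _ (f.measurableSet_fiber _))
    _ = ∏ x : f.range, expNeg ((1 - expNeg x) * Λ (f ⁻¹' {(x : ℝ≥0∞)})) := by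
        refine Finset.prod_congr rfl fun x _ => ?_
        by_cases hx : (x : ℝ≥0∞) = 0
        · simp [hx, expNeg_zero, measure_univ]
        · exact h.lintegral_expNeg_count (f.measurableSet_fiber _)
            (SimpleFunc.finMeasSupp_iff.1 hf _ hx).ne _
    _ = expNeg (∫⁻ y, f.map (fun x => 1 - expNeg x) y ∂Λ) := by
        rw [SimpleFunc.lintegral_eq_lintegral, SimpleFunc.map_lintegral, expNeg_sum,
          ← Finset.prod_coe_sort f.range]

theorem hasPoissonLaplace [SigmaFinite Λ] (h : IsPoissonProcess P Φ Λ) :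
    HasPoissonLaplace P (fun ω => pointMeasure (Φ ω)) Λ := by
  have := h.isProbabilityMeasure
  intro f hf
  obtain ⟨g, hg, h_mono, h_lim⟩ := exists_monotone_finMeasSupp_tendsto Λ hf
  have h_point ω := (continuous_expNeg.tendsto _).comp <|
    lintegral_tendsto_of_tendsto_of_monotone (μ := pointMeasure (Φ ω))
      (fun n => (g n).measurable.aemeasurable) (Eventually.of_forall h_mono)
      (Eventually.of_forall h_lim)
  have h_left : Tendsto (fun n => ∫⁻ ω, expNeg (∫⁻ y, g n y ∂(pointMeasure (Φ ω))) ∂P) atTop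
      (𝓝 (∫⁻ ω, expNeg (∫⁻ y, f y ∂(pointMeasure (Φ ω))) ∂P)) := by
    refine tendsto_lintegral_of_dominated_convergence (fun _ => 1) (fun n => ?_)
      (fun n => Eventually.of_forall fun ω => expNeg_le_one _) (by simp)
      (Eventually.of_forall h_point)
    exact measurable_expNeg.comp ((Measure.measurable_lintegral (g n).measurable).comp
      (measurable_pointMeasure h.measurable_count))
  have h_right := (continuous_expNeg.tendsto _).comp
    (tendsto_lintegral_one_sub_expNeg (Λ := Λ) (fun n => (g n).measurable) h_mono h_lim)
  rw [measure_univ, one_mul]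
  exact tendsto_nhds_unique h_left
    (h_right.congr fun n => (h.lintegral_expNeg_simpleFunc (hg n)).symm)

end IsPoissonProcess

end PoissonLaplace

section DyadicCeil

/-- The least multiple of `2⁻ⁿ` that is at least `x`. -/
def dyadicCeil (n : ℕ) (x : ℝ) : ℝ := ⌈x * 2 ^ n⌉ / 2 ^ n

lemma le_dyadicCeil (n : ℕ) (x : ℝ) : x ≤ dyadicCeil n x :=
  (le_div_iff₀ (by positivity)).2 (Int.le_ceil _)

lemma dyadicCeil_lt (n : ℕ) (x : ℝ) : dyadicCeil n x < x + (1 / 2) ^ n := by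
  rw [dyadicCeil, div_lt_iff₀ (by positivity), add_mul, ← mul_pow]
  simpa using Int.ceil_lt_add_one (x * 2 ^ n)

lemma antitone_dyadicCeil (x : ℝ) : Antitone fun n => dyadicCeil n x := by
  refine antitone_nat_of_succ_le fun n => ?_
  have h_ceil : ⌈x * 2 ^ (n + 1)⌉ ≤ ⌈x * 2 ^ n⌉ * 2 := by
    rw [Int.ceil_le, pow_succ]
    push_cast
    linarith [Int.le_ceil (x * 2 ^ n)]
  calc dyadicCeil (n + 1) x ≤ (⌈x * 2 ^ n⌉ * 2 : ℤ) / 2 ^ (n + 1) := by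
        rw [dyadicCeil]
        gcongr
    _ = dyadicCeil n x := by
        rw [dyadicCeil, pow_succ, Int.cast_mul, Int.cast_ofNat, mul_div_mul_right _ _ two_ne_zero]

lemma iUnion_dyadicCeil_lt {E : Type*} (κ : E → ℝ) (x : ℝ) :
    ⋃ n, {y | dyadicCeil n x < κ y} = {y | x < κ y} := by
  ext y
  simp only [Set.mem_iUnion, Set.mem_ofPred_eq]
  refine ⟨fun ⟨n, hn⟩ => (le_dyadicCeil n x).trans_lt hn, fun hy => ?_⟩
  obtain ⟨n, hn⟩ := exists_pow_lt_of_lt_one (sub_pos.2 hy) (by norm_num : (1 / 2 : ℝ) < 1)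
  exact ⟨n, (dyadicCeil_lt n x).trans (by linarith)⟩

lemma tendsto_setLIntegral_dyadicCeil_lt {E : Type*} [MeasurableSpace E] {μ : Measure E}
    {κ : E → ℝ} (hκ : Measurable κ) (f : E → ℝ≥0∞) (x : ℝ) :
    Tendsto (fun n => ∫⁻ y in {y | dyadicCeil n x < κ y}, f y ∂μ) atTop
      (𝓝 (∫⁻ y in {y | x < κ y}, f y ∂μ)) := by
  have h_meas (a : ℝ) : MeasurableSet {y | a < κ y} := measurableSet_lt measurable_const hκ
  simp_rw [← withDensity_apply f (h_meas _)]
  rw [← iUnion_dyadicCeil_lt κ x]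
  exact tendsto_measure_iUnion_atTop fun n m hnm y hy =>
    lt_of_le_of_lt (antitone_dyadicCeil x hnm) hy

end DyadicCeil

section FirstPoint

variable {E Ω : Type*} [MeasurableSpace E] [MeasurableSpace Ω] {Q : Measure Ω}

lemma lintegral_eq_of_forall_fiber {ι : Type*} [Countable ι] [MeasurableSpace ι]
    [MeasurableSingletonClass ι] {X : Ω → ι} (hX : Measurable X) {F G : Ω → ℝ≥0∞}
    (h : ∀ k, ∫⁻ ω in X ⁻¹' {k}, F ω ∂Q = ∫⁻ ω in X ⁻¹' {k}, G ω ∂Q) :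
    ∫⁻ ω, F ω ∂Q = ∫⁻ ω, G ω ∂Q := by
  have h_fiber k : MeasurableSet (X ⁻¹' {k}) := hX (measurableSet_singleton k)
  have h_union : ⋃ k, X ⁻¹' {k} = Set.univ := Set.iUnion_eq_univ_iff.2 fun ω => ⟨X ω, rfl⟩
  rw [← setLIntegral_univ, ← setLIntegral_univ G, ← h_union,
    lintegral_iUnion h_fiber (pairwise_disjoint_fiber X),
    lintegral_iUnion h_fiber (pairwise_disjoint_fiber X)]
  exact tsum_congr h

variable {N : Ω → Measure E} {Λ : Measure E} {κ : E → ℝ} {L : Ω → ℝ} {f : E → ℝ≥0∞}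

/-- The random variable `L` is almost surely the least value of the coordinate `κ` at the points of
the point process `N`. It is encoded through void events, so that no first point has to be
selected. -/
def IsFirstValue (Q : Measure Ω) (N : Ω → Measure E) (κ : E → ℝ) (L : Ω → ℝ) : Prop :=
  ∀ᵐ ω ∂Q, ∀ u, u < L ω ↔ N ω {y | κ y ≤ u} = 0

-- The Laplace functional at `∞ · 1{κ ≤ u} + f · 1{v < κ}` picks out the void event `{u < L}`.
lemma setLIntegral_lt_first (hN : HasPoissonLaplace Q N Λ) (hκ : Measurable κ) (hL : Measurable L)
    (h_first : IsFirstValue Q N κ L) (hf : Measurable f) {u v : ℝ} (huv : u ≤ v) :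
    ∫⁻ ω in {ω | u < L ω}, expNeg (∫⁻ y in {y | v < κ y}, f y ∂N ω) ∂Q =
      Q Set.univ * expNeg (Λ {y | κ y ≤ u}) *
        expNeg (∫⁻ y in {y | v < κ y}, 1 - expNeg (f y) ∂Λ) := by
  have hA : MeasurableSet {y | κ y ≤ u} := measurableSet_le hκ measurable_const
  have hB : MeasurableSet {y | v < κ y} := measurableSet_lt measurable_const hκ
  have h_void : Measurable ({y | κ y ≤ u}.indicator fun _ => (∞ : ℝ≥0∞)) :=
    measurable_const.indicator hA
  have h_split y : 1 - expNeg ({y | κ y ≤ u}.indicator (fun _ => ∞) y + {y | v < κ y}.indicator f y)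
      = {y | κ y ≤ u}.indicator 1 y + {y | v < κ y}.indicator (fun y => 1 - expNeg (f y)) y := by
    by_cases hu : κ y ≤ u
    · simp [hu, (hu.trans huv).not_gt, expNeg_top]
    · by_cases hv : v < κ y <;> simp [hu, hv, expNeg_zero]
  have h_laplace := hN _ (h_void.add (hf.indicator hB))
  simp only [Pi.add_apply, h_split] at h_laplace
  rw [lintegral_add_left (measurable_one.indicator hA), lintegral_indicator_one hA,
    lintegral_indicator hB, expNeg_add, ← mul_assoc] at h_laplace
  rw [← h_laplace, ← lintegral_indicator (measurableSet_lt measurable_const hL)]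
  refine lintegral_congr_ae (h_first.mono fun ω hω => ?_)
  dsimp only
  rw [lintegral_add_left h_void, lintegral_indicator hA, lintegral_indicator hB, expNeg_add,
    setLIntegral_const]
  by_cases hu : u < L ω
  · rw [Set.indicator_of_mem (by exact hu), (hω u).1 hu, mul_zero, expNeg_zero, one_mul]
  · rw [Set.indicator_of_notMem (by exact hu), ENNReal.top_mul fun h0 => hu ((hω u).2 h0),
      expNeg_top, zero_mul]

lemma measure_lt_first (hN : HasPoissonLaplace Q N Λ) (hκ : Measurable κ) (hL : Measurable L)
    (h_first : IsFirstValue Q N κ L) (u : ℝ) :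
    Q {ω | u < L ω} = Q Set.univ * expNeg (Λ {y | κ y ≤ u}) := by
  simpa [expNeg_zero] using
    setLIntegral_lt_first hN hκ hL h_first (f := fun _ => 0) measurable_const le_rfl

lemma setLIntegral_first_mem_Ioc [IsFiniteMeasure Q] (hN : HasPoissonLaplace Q N Λ)
    (hκ : Measurable κ) (hL : Measurable L) (h_first : IsFirstValue Q N κ L) (hf : Measurable f)
    (u v : ℝ) :
    ∫⁻ ω in {ω | L ω ∈ Set.Ioc u v}, expNeg (∫⁻ y in {y | v < κ y}, f y ∂N ω) ∂Q =
      Q {ω | L ω ∈ Set.Ioc u v} * expNeg (∫⁻ y in {y | v < κ y}, 1 - expNeg (f y) ∂Λ) := by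
  rcases lt_or_ge v u with hvu | huv
  · simp [Set.Ioc_eq_empty_of_le hvu.le]
  have h_union : {ω | u < L ω} = {ω | L ω ∈ Set.Ioc u v} ∪ {ω | v < L ω} := by
    ext ω
    exact (Set.ext_iff.1 (Set.Ioc_union_Ioi_eq_Ioi huv) (L ω)).symm
  have h_disj : Disjoint {ω | L ω ∈ Set.Ioc u v} {ω | v < L ω} :=
    Set.disjoint_left.2 fun ω h h' => not_lt.2 h.2 h'
  have h_meas : MeasurableSet {ω | v < L ω} := measurableSet_lt measurable_const hL
  have hu := setLIntegral_lt_first hN hκ hL h_first hf huv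
  have hv := setLIntegral_lt_first hN hκ hL h_first hf (le_refl v)
  rw [← measure_lt_first hN hκ hL h_first] at hu hv
  rw [h_union, lintegral_union h_meas h_disj, measure_union h_disj h_meas, add_mul, hv] at hu
  exact (ENNReal.add_left_inj (ENNReal.mul_ne_top (measure_ne_top _ _) (expNeg_ne_top _))).1 hu

lemma setLIntegral_beyond_dyadicCeil_first [IsFiniteMeasure Q] (hN : HasPoissonLaplace Q N Λ)
    (hκ : Measurable κ) (hL : Measurable L) (h_first : IsFirstValue Q N κ L) (hf : Measurable f)
    (r : ℝ) (n : ℕ) :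
    ∫⁻ ω in {ω | r < L ω}, expNeg (∫⁻ y in {y | dyadicCeil n (L ω) < κ y}, f y ∂N ω) ∂Q =
      ∫⁻ ω in {ω | r < L ω},
        expNeg (∫⁻ y in {y | dyadicCeil n (L ω) < κ y}, 1 - expNeg (f y) ∂Λ) ∂Q := by
  have h_ceil : Measurable fun ω => ⌈L ω * 2 ^ n⌉ := (hL.mul_const _).ceil
  refine lintegral_eq_of_forall_fiber h_ceil fun k => ?_
  have h_cell : (fun ω => ⌈L ω * 2 ^ n⌉) ⁻¹' {k} ∩ {ω | r < L ω} =
      {ω | L ω ∈ Set.Ioc (max r ((k - 1) / 2 ^ n)) (k / 2 ^ n)} := by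
    ext ω
    simp only [Set.mem_inter_iff, Set.mem_preimage, Set.mem_singleton_iff, Set.mem_ofPred_eq,
      Set.mem_Ioc, Int.ceil_eq_iff, max_lt_iff, div_lt_iff₀ (pow_pos (zero_lt_two (α := ℝ)) n),
      le_div_iff₀ (pow_pos (zero_lt_two (α := ℝ)) n)]
    tauto
  have h_eq : ∀ ω ∈ {ω | L ω ∈ Set.Ioc (max r ((k - 1) / 2 ^ n)) (k / 2 ^ n)},
      dyadicCeil n (L ω) = k / 2 ^ n := fun ω hω => by
    rw [← h_cell] at hω
    rw [dyadicCeil, show ⌈L ω * 2 ^ n⌉ = k from hω.1]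
  have h_meas : MeasurableSet {ω | L ω ∈ Set.Ioc (max r ((k - 1) / 2 ^ n)) ((k : ℝ) / 2 ^ n)} :=
    hL measurableSet_Ioc
  rw [Measure.restrict_restrict (h_ceil (measurableSet_singleton k)), h_cell,
    setLIntegral_congr_fun h_meas fun ω hω => by rw [h_eq ω hω],
    setLIntegral_first_mem_Ioc hN hκ hL h_first hf, mul_comm, ← setLIntegral_const]
  exact setLIntegral_congr_fun h_meas fun ω hω => by rw [h_eq ω hω]

lemma measurable_setLIntegral_beyond_dyadicCeil (hN : Measurable N) (hκ : Measurable κ)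
    (hL : Measurable L) (hf : Measurable f) (n : ℕ) :
    Measurable fun ω => ∫⁻ y in {y | dyadicCeil n (L ω) < κ y}, f y ∂N ω := by
  have h_grid : Measurable fun p : ℤ × Ω => ∫⁻ y in {y | p.1 / 2 ^ n < κ y}, f y ∂N p.2 := by
    refine measurable_from_prod_countable_right fun k => ?_
    have h_meas : MeasurableSet {y | (k : ℝ) / 2 ^ n < κ y} := measurableSet_lt measurable_const hκ
    simp_rw [← lintegral_indicator h_meas]
    exact (Measure.measurable_lintegral (hf.indicator h_meas)).comp hN
  simpa only [Function.comp_def, dyadicCeil, id] using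
    h_grid.comp ((hL.mul_const (2 ^ n)).ceil.prodMk measurable_id)

lemma tendsto_setLIntegral_beyond_dyadicCeil [IsFiniteMeasure Q] (hN : Measurable N)
    (hκ : Measurable κ) (hL : Measurable L) (hf : Measurable f) (A : Set Ω) :
    Tendsto (fun n => ∫⁻ ω in A, expNeg (∫⁻ y in {y | dyadicCeil n (L ω) < κ y}, f y ∂N ω) ∂Q)
      atTop (𝓝 (∫⁻ ω in A, expNeg (∫⁻ y in {y | L ω < κ y}, f y ∂N ω) ∂Q)) :=
  tendsto_lintegral_of_dominated_convergence (fun _ => 1)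
    (fun n => measurable_expNeg.comp (measurable_setLIntegral_beyond_dyadicCeil hN hκ hL hf n))
    (fun _ => Eventually.of_forall fun _ => expNeg_le_one _) (by simp)
    (Eventually.of_forall fun ω =>
      (continuous_expNeg.tendsto _).comp (tendsto_setLIntegral_dyadicCeil_lt hκ f (L ω)))

lemma setLIntegral_lt_beyond_first [IsFiniteMeasure Q] (hN : HasPoissonLaplace Q N Λ)
    (hN_meas : Measurable N) (hκ : Measurable κ) (hL : Measurable L)
    (h_first : IsFirstValue Q N κ L) (hf : Measurable f) (r : ℝ) :
    ∫⁻ ω in {ω | r < L ω}, expNeg (∫⁻ y in {y | L ω < κ y}, f y ∂N ω) ∂Q =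
      ∫⁻ ω in {ω | r < L ω}, expNeg (∫⁻ y in {y | L ω < κ y}, 1 - expNeg (f y) ∂Λ) ∂Q := by
  have h_left := tendsto_setLIntegral_beyond_dyadicCeil (Q := Q) hN_meas hκ hL hf {ω | r < L ω}
  have h_right := tendsto_setLIntegral_beyond_dyadicCeil (Q := Q) (N := fun _ => Λ)
    measurable_const hκ hL (f := fun y => 1 - expNeg (f y)) (by fun_prop) {ω | r < L ω}
  exact tendsto_nhds_unique h_left (h_right.congr fun n =>
    (setLIntegral_beyond_dyadicCeil_first hN hκ hL h_first hf r n).symm)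

lemma measurable_setLIntegral_lt (Λ : Measure E) (κ : E → ℝ) (f : E → ℝ≥0∞) :
    Measurable fun l => ∫⁻ y in {y | l < κ y}, f y ∂Λ :=
  Antitone.measurable fun _ _ h => lintegral_mono_set fun _ hy => h.trans_lt hy

lemma measure_ext_of_Ioi {μ ν : Measure ℝ} [IsFiniteMeasure μ] [IsFiniteMeasure ν]
    (h : ∀ r, μ (Set.Ioi r) = ν (Set.Ioi r)) : μ = ν := by
  refine Measure.ext_of_Ioc μ ν fun a b hab => ?_
  have h_sub : Set.Ioi b ⊆ Set.Ioi a := Set.Ioi_subset_Ioi hab.le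
  rw [← Set.Ioi_sdiff_Ioi, measure_sdiff h_sub measurableSet_Ioi.nullMeasurableSet
    (measure_ne_top _ _), measure_sdiff h_sub measurableSet_Ioi.nullMeasurableSet
    (measure_ne_top _ _), h, h]

theorem setLIntegral_beyond_first [IsFiniteMeasure Q] (hN : HasPoissonLaplace Q N Λ)
    (hN_meas : Measurable N) (hκ : Measurable κ) (hL : Measurable L)
    (h_first : IsFirstValue Q N κ L) (hf : Measurable f) {B : Set ℝ} (hB : MeasurableSet B) :
    ∫⁻ ω in L ⁻¹' B, expNeg (∫⁻ y in {y | L ω < κ y}, f y ∂N ω) ∂Q =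
      ∫⁻ l in B, expNeg (∫⁻ y in {y | l < κ y}, 1 - expNeg (f y) ∂Λ) ∂Q.map L := by
  set X : Ω → ℝ≥0∞ := fun ω => expNeg (∫⁻ y in {y | L ω < κ y}, f y ∂N ω)
  set Y : ℝ → ℝ≥0∞ := fun l => expNeg (∫⁻ y in {y | l < κ y}, 1 - expNeg (f y) ∂Λ)
  have hY : Measurable Y := measurable_expNeg.comp (measurable_setLIntegral_lt Λ κ _)
  have : IsFiniteMeasure (Q.withDensity X) := isFiniteMeasure_withDensity
    ((lintegral_mono fun _ => expNeg_le_one _).trans_lt (by simp)).ne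
  have : IsFiniteMeasure ((Q.map L).withDensity Y) := isFiniteMeasure_withDensity
    ((lintegral_mono fun _ => expNeg_le_one _).trans_lt (by simp)).ne
  have h_eq : (Q.withDensity X).map L = (Q.map L).withDensity Y := by
    refine measure_ext_of_Ioi fun r => ?_
    rw [Measure.map_apply hL measurableSet_Ioi, withDensity_apply _ (hL measurableSet_Ioi),
      withDensity_apply _ measurableSet_Ioi, setLIntegral_map measurableSet_Ioi hY hL]
    exact setLIntegral_lt_beyond_first hN hN_meas hκ hL h_first hf r
  rw [← withDensity_apply _ (hL hB), ← withDensity_apply _ hB, ← h_eq, Measure.map_apply hL hB]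

end FirstPoint

section Ties

variable {E Ω : Type*} [MeasurableSpace E] [MeasurableSpace Ω]

lemma poissonMeasure_two_le_le_sq (r : ℝ≥0) : poissonMeasure r {n | 2 ≤ n} ≤ (r : ℝ≥0∞) ^ 2 := by
  have h_compl : {n : ℕ | 2 ≤ n} = ({0} ∪ {1} : Set ℕ)ᶜ := by
    ext n
    simp only [Set.mem_compl_iff, Set.mem_ofPred_eq, Set.mem_union, Set.mem_singleton_iff]
    omega
  rw [h_compl, prob_compl_eq_one_sub MeasurableSet.of_discrete,
    measure_union (by simp) (measurableSet_singleton 1), poissonMeasure_singleton,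
    poissonMeasure_singleton, ← ENNReal.ofReal_add (by positivity) (by positivity),
    ← ENNReal.ofReal_one, ← ENNReal.ofReal_sub _ (by positivity), ← ENNReal.ofReal_coe_nnreal,
    ← ENNReal.ofReal_pow r.coe_nonneg]
  refine ENNReal.ofReal_le_ofReal ?_
  simp only [pow_zero, pow_one, mul_one, Nat.factorial_zero, Nat.factorial_one, Nat.cast_one,
    div_one]
  nlinarith [Real.add_one_le_exp (-(r : ℝ)), r.coe_nonneg]

lemma prod_self_eq_fiber {ι : Type*} [Countable ι] [MeasurableSpace ι] [MeasurableSingletonClass ι]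
    {μ : Measure E} [SFinite μ] {X : E → ι} (hX : Measurable X) :
    (μ.prod μ) {p | X p.1 = X p.2} = ∑' k, μ (X ⁻¹' {k}) ^ 2 := by
  have h_fiber k : MeasurableSet (X ⁻¹' {k}) := hX (measurableSet_singleton k)
  have h_union : {p : E × E | X p.1 = X p.2} = ⋃ k, (X ⁻¹' {k}) ×ˢ (X ⁻¹' {k}) := by
    ext p
    simp [eq_comm]
  rw [h_union, measure_iUnion
    (fun i j hij => Set.disjoint_prod.2 (Or.inl (pairwise_disjoint_fiber X hij)))
    fun k => (h_fiber k).prod (h_fiber k)]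
  simp_rw [Measure.prod_prod, sq]

namespace IsPoissonProcess

variable {P : Measure Ω} {Φ : Ω → Set E} {Λ : Measure E}

lemma measure_count_mem (h : IsPoissonProcess P Φ Λ) {A : Set E} (hA : MeasurableSet A)
    (h_fin : Λ A ≠ ∞) (s : Set ℕ∞) :
    P {ω | count (Φ ω) A ∈ s} = poissonMeasure (Λ A).toNNReal {n : ℕ | (n : ℕ∞) ∈ s} := by
  have h_law := congrArg (fun μ => μ s) (h.law_count A hA h_fin)
  simp only [Measure.map_apply (h.measurable_count A hA) (MeasurableSet.of_discrete (s := s)),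
    Measure.map_apply measurable_from_top (MeasurableSet.of_discrete (s := s))] at h_law
  exact h_law

lemma ae_count_ne_top (h : IsPoissonProcess P Φ Λ) {A : Set E} (hA : MeasurableSet A)
    (h_fin : Λ A ≠ ∞) : ∀ᵐ ω ∂P, count (Φ ω) A ≠ ⊤ := by
  rw [ae_iff]
  simpa using h.measure_count_mem hA h_fin {⊤}

lemma measure_two_le_count_le (h : IsPoissonProcess P Φ Λ) {A : Set E} (hA : MeasurableSet A)
    (h_fin : Λ A ≠ ∞) : P {ω | 2 ≤ count (Φ ω) A} ≤ Λ A ^ 2 := by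
  have h_law := h.measure_count_mem hA h_fin (Set.Ici 2)
  simp only [Set.mem_Ici, Nat.ofNat_le_cast] at h_law
  rw [h_law]
  simpa only [ENNReal.coe_toNNReal h_fin] using poissonMeasure_two_le_le_sq (Λ A).toNNReal

lemma ae_nonempty [SigmaFinite Λ] (h : IsPoissonProcess P Φ Λ)
    (hΛ : Λ Set.univ = ∞) : ∀ᵐ ω ∂P, (Φ ω).Nonempty := by
  have h_laplace := h.hasPoissonLaplace (fun _ => ∞) measurable_const
  simp only [lintegral_const, expNeg_top, tsub_zero, hΛ, one_mul, mul_zero] at h_laplace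
  have h_meas : Measurable fun ω => expNeg (∞ * pointMeasure (Φ ω) Set.univ) :=
    measurable_expNeg.comp (((Measure.measurable_coe MeasurableSet.univ).comp
      (measurable_pointMeasure h.measurable_count)).const_mul _)
  refine ((lintegral_eq_zero_iff h_meas).1 h_laplace).mono fun ω hω => ?_
  by_contra h_empty
  rw [Set.not_nonempty_iff_eq_empty] at h_empty
  simp [h_empty, pointMeasure_apply, count, expNeg_zero] at hω

lemma measure_not_injOn_le (h : IsPoissonProcess P Φ Λ) {ι : Type*} [Countable ι]
    [MeasurableSpace ι] [MeasurableSingletonClass ι] {X : E → ι} (hX : Measurable X) {A : Set E}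
    (hA : MeasurableSet A) (h_fin : Λ A ≠ ∞) :
    P {ω | ¬ Set.InjOn X (Φ ω ∩ A)} ≤
      ((Λ.restrict A).prod (Λ.restrict A)) {p | X p.1 = X p.2} := by
  have : IsFiniteMeasure (Λ.restrict A) := isFiniteMeasure_restrict.2 h_fin
  have h_fiber k : MeasurableSet (X ⁻¹' {k}) := hX (measurableSet_singleton k)
  have h_two : {ω | ¬ Set.InjOn X (Φ ω ∩ A)} ⊆ ⋃ k, {ω | 2 ≤ count (Φ ω) (X ⁻¹' {k} ∩ A)} := by
    intro ω hω
    simp only [Set.mem_ofPred_eq, Set.InjOn] at hω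
    push Not at hω
    obtain ⟨y, hy, z, hz, hyz, hne⟩ := hω
    refine Set.mem_iUnion.2 ⟨X y, ?_⟩
    rw [Set.mem_ofPred_eq, count, ← one_add_one_eq_two]
    exact Order.add_one_le_of_lt (Set.one_lt_encard_iff.2
      ⟨y, z, ⟨hy.1, rfl, hy.2⟩, ⟨hz.1, hyz.symm, hz.2⟩, hne⟩)
  rw [prod_self_eq_fiber hX]
  refine (measure_mono h_two).trans ((measure_iUnion_le _).trans
    (ENNReal.tsum_le_tsum fun k => ?_))
  rw [Measure.restrict_apply (h_fiber k)]
  exact h.measure_two_le_count_le ((h_fiber k).inter hA)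
    (measure_ne_top_of_subset Set.inter_subset_right h_fin)

lemma ae_injOn_inter (h : IsPoissonProcess P Φ Λ) {κ : E → ℝ} (hκ : Measurable κ) {A : Set E}
    (hA : MeasurableSet A) (h_fin : Λ A ≠ ∞) (h_diffuse : ∀ t, Λ {y | κ y = t} = 0) :
    ∀ᵐ ω ∂P, Set.InjOn κ (Φ ω ∩ A) := by
  have : IsFiniteMeasure (Λ.restrict A) := isFiniteMeasure_restrict.2 h_fin
  set μ := (Λ.restrict A).prod (Λ.restrict A)
  have h_diff : Measurable fun p : E × E => κ p.1 - κ p.2 := by fun_prop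
  have h_diagonal : μ.map (fun p => κ p.1 - κ p.2) {0} = 0 := by
    rw [Measure.map_apply h_diff (measurableSet_singleton 0),
      Measure.measure_prod_null (h_diff (measurableSet_singleton 0))]
    refine Eventually.of_forall fun y => Measure.absolutelyContinuous_of_le
      Measure.restrict_le_self (measure_mono_null (fun z hz => ?_) (h_diffuse (κ y)))
    exact (sub_eq_zero.1 hz).symm
  have h_mesh : ∀ δ > 0, P {ω | ¬ Set.InjOn κ (Φ ω ∩ A)} ≤
      μ.map (fun p => κ p.1 - κ p.2) (Set.Icc (0 - δ) (0 + δ)) := by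
    intro δ hδ
    rw [Measure.map_apply h_diff measurableSet_Icc]
    refine (measure_mono fun ω (hω : ¬ _) (h_inj : Set.InjOn (fun y => ⌊κ y / δ⌋) _) =>
      hω fun y hy z hz hyz => h_inj hy hz (by simp only [hyz])).trans
      ((h.measure_not_injOn_le (hκ.div_const δ).floor hA h_fin).trans
        (measure_mono fun p hp => ?_))
    have h_lt := Int.abs_sub_lt_one_of_floor_eq_floor hp
    rw [← sub_div, abs_div, abs_of_pos hδ, div_lt_one hδ, abs_lt] at h_lt
    exact ⟨by linarith, by linarith⟩
  rw [ae_iff]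
  refine le_antisymm (ge_of_tendsto (h_diagonal ▸ tendsto_measure_Icc_nhdsWithin_right' _ 0) ?_)
    zero_le
  filter_upwards [self_mem_nhdsWithin] with δ hδ using h_mesh δ hδ

theorem ae_injOn (h : IsPoissonProcess P Φ Λ) {κ : E → ℝ} (hκ : Measurable κ)
    (h_fin : ∀ R, Λ {y | κ y ≤ R} ≠ ∞) (h_diffuse : ∀ t, Λ {y | κ y = t} = 0) :
    ∀ᵐ ω ∂P, Set.InjOn κ (Φ ω) := by
  have h_nat (R : ℕ) := h.ae_injOn_inter hκ (measurableSet_le hκ measurable_const)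
    (h_fin R) h_diffuse
  filter_upwards [ae_all_iff.2 h_nat] with ω hω y hy z hz hyz
  obtain ⟨R, hR⟩ := exists_nat_ge (κ y)
  exact hω R ⟨hy, hR⟩ ⟨hz, hyz.symm.trans_le hR⟩ hyz

end IsPoissonProcess

end Ties

section Serving

variable {NBS NUE : ℕ} {c : Params NBS NUE} {S : Set (Station NBS NUE)}

lemma exists_isServing (h_nonempty : S.Nonempty)
    (h_fin : ∀ R : ℕ, count S {y | pathLoss c y.1 ≤ R} ≠ ⊤) : ∃ x, IsServing c S x := by
  obtain ⟨y, hy⟩ := h_nonempty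
  obtain ⟨R, hR⟩ := exists_nat_ge (pathLoss c y.1)
  obtain ⟨x, hx, h_min⟩ := Set.exists_min_image _ (fun y => pathLoss c y.1)
    (Set.encard_ne_top_iff.1 (h_fin R)) ⟨y, hy, hR⟩
  refine ⟨x, hx.1, fun z hz => ?_⟩
  rcases le_total (pathLoss c z.1) R with h | h
  · exact h_min z ⟨hz, h⟩
  · exact (show _ ≤ (R : ℝ) from hx.2).trans h

lemma servingBS_eq (h_inj : Set.InjOn (fun y => pathLoss c y.1) S) {x : Station NBS NUE}
    (hx : IsServing c S x) : servingBS c S = some x := by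
  have h : ∃ x, IsServing c S x := ⟨x, hx⟩
  rw [servingBS, dif_pos h]
  exact congrArg some (h_inj h.choose_spec.1 hx.1
    (le_antisymm (h.choose_spec.2 x hx.1) (hx.2 _ h.choose_spec.1)))

lemma servingLoss_eq (h_inj : Set.InjOn (fun y => pathLoss c y.1) S) {x : Station NBS NUE}
    (hx : IsServing c S x) : servingLoss c S = pathLoss c x.1 := by
  rw [servingLoss, servingBS_eq h_inj hx]

lemma lt_servingLoss_iff (h_inj : Set.InjOn (fun y => pathLoss c y.1) S)
    (h_serving : ∃ x, IsServing c S x) (u : ℝ) :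
    u < servingLoss c S ↔ count S {y | pathLoss c y.1 ≤ u} = 0 := by
  obtain ⟨x, hx⟩ := h_serving
  rw [servingLoss_eq h_inj hx, count, Set.encard_eq_zero, ← Set.disjoint_iff_inter_eq_empty,
    Set.disjoint_left]
  exact ⟨fun hu y hy hyu => not_lt.2 hyu (hu.trans_le (hx.2 y hy)), fun h => not_le.1 (h hx.1)⟩

lemma setOf_ne_servingBS_eq (h_inj : Set.InjOn (fun y => pathLoss c y.1) S)
    (h_serving : ∃ x, IsServing c S x) :
    {y | y ∈ S ∧ some y ≠ servingBS c S} = S ∩ {y | servingLoss c S < pathLoss c y.1} := by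
  obtain ⟨x, hx⟩ := h_serving
  ext y
  rw [servingLoss_eq h_inj hx, servingBS_eq h_inj hx]
  refine and_congr_right fun hy => ⟨fun h => ?_, fun h h_eq => ?_⟩
  · exact (hx.2 y hy).lt_of_ne fun h_eq => h (congrArg some (h_inj hy hx.1 h_eq.symm))
  · exact lt_irrefl (pathLoss c x.1) (Option.some.inj h_eq ▸ h)

end Serving

section Measurability

variable {NBS NUE : ℕ} (c : Params NBS NUE)

lemma measurable_comp_countable {ι α β : Type*} [MeasurableSpace ι] [Countable ι]
    [MeasurableSingletonClass ι] [MeasurableSpace α] [MeasurableSpace β] {f : ι → α → β}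
    (hf : ∀ i, Measurable (f i)) {g : α → ι} (hg : Measurable g) :
    Measurable fun a => f (g a) a :=
  (measurable_from_prod_countable_right hf :
    Measurable fun p : ι × α => f p.1 p.2).comp (hg.prodMk measurable_id)

@[fun_prop]
lemma measurable_pathLoss : Measurable (pathLoss c) := by
  have h_alpha : Measurable c.alpha := measurable_of_countable _
  have h_log : Measurable (Real.logb 10) := Real.measurable_log.div_const _
  unfold pathLoss pathLossDB
  fun_prop

lemma pathLoss_pos (y : Link) : 0 < pathLoss c y := Real.rpow_pos_of_pos (by norm_num) _

@[fun_prop]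
lemma measurable_chi (φ₀ : Fin NUE) (j w : ℕ) :
    Measurable fun a : Angles NBS NUE => chi c φ₀ a j w := by
  have h_arrival : Measurable fun φ => beamInner c.rhoUE φ₀ φ := measurable_of_countable _
  have h_departure : Measurable fun θ : Fin NBS × Fin NBS => beamInner c.rhoBS θ.1 θ.2 :=
    measurable_of_countable _
  exact (h_arrival.comp (by fun_prop)).mul (h_departure.comp
    (by fun_prop : Measurable fun a : Angles NBS NUE => (a.2.1 j, a.2.2 w)))

/-- The normalised interference `(s G / (t η U)) ∑_w |∑_j γ_j χ_{j,w}|²` of a BS at path loss `t`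
whose link has `η` paths and which serves `U` users. -/
def scaledPower (φ₀ : Fin NUE) (s : ℝ) (η U : ℕ) (t : ℝ) (γ : ℕ → ℂ) (a : Angles NBS NUE) : ℝ :=
  s * gain c * t⁻¹ / (η * U) * ∑ w ∈ Finset.range U,
    ‖∑ j ∈ Finset.range η, γ j * (chi c φ₀ a j w : ℂ)‖ ^ 2

lemma mul_power (φ₀ : Fin NUE) (s : ℝ) (y : Station NBS NUE) :
    s * power c φ₀ y =
      scaledPower c φ₀ s (c.eta y.1.2.1) y.2.1 (pathLoss c y.1) y.2.2.1 y.2.2.2 := by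
  rw [power, scaledPower]
  field_simp

@[fun_prop]
lemma measurable_scaledPower (φ₀ : Fin NUE) (s : ℝ) (η U : ℕ) :
    Measurable fun z : ℝ × (ℕ → ℂ) × Angles NBS NUE =>
      scaledPower c φ₀ s η U z.1 z.2.1 z.2.2 := by
  unfold scaledPower
  fun_prop

@[fun_prop]
lemma measurable_power (φ₀ : Fin NUE) : Measurable (power c φ₀) := by
  have h_scaled := measurable_comp_countable (α := Station NBS NUE)
    (g := fun y => (y.1.2.1, y.2.1)) (f := fun (i : Bool × ℕ) y =>
      scaledPower c φ₀ 1 (c.eta i.1) i.2 (pathLoss c y.1) y.2.2.1 y.2.2.2)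
    (fun i => (measurable_scaledPower c φ₀ 1 _ _).comp
      (by fun_prop : Measurable fun y : Station NBS NUE => (pathLoss c y.1, y.2.2))) (by fun_prop)
  simpa only [← mul_power, one_mul] using h_scaled

lemma interference_eq {S : Set (Station NBS NUE)} (h_inj : Set.InjOn (fun y => pathLoss c y.1) S)
    (h_serving : ∃ x, IsServing c S x) (φ₀ : Fin NUE) :
    interference c S φ₀ = ∫⁻ y in {y | servingLoss c S < pathLoss c y.1},
      ENNReal.ofReal (power c φ₀ y) ∂(pointMeasure S) := by
  have h_meas : MeasurableSet {y : Station NBS NUE | servingLoss c S < pathLoss c y.1} :=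
    measurableSet_lt measurable_const (by fun_prop)
  rw [← lintegral_indicator h_meas,
    lintegral_pointMeasure _ ((measurable_power c φ₀).ennreal_ofReal.indicator h_meas),
    tsum_subtype S, Set.indicator_indicator, ← setOf_ne_servingBS_eq h_inj h_serving,
    ← tsum_subtype]
  rfl

end Measurability

section LinkIntensity

variable {NBS NUE : ℕ} (c : Params NBS NUE)

lemma measurable_stateProb (b : Bool) : Measurable (stateProb c b) :=
  Measurable.ite (measurableSet_le measurable_norm measurable_const) measurable_const
    measurable_const

lemma stateProb_add (x : EuclideanSpace ℝ (Fin 2)) :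
    stateProb c true x + stateProb c false x = 1 := by
  simp only [stateProb, if_true, Bool.false_eq_true, if_false]
  split_ifs
  · rw [← ENNReal.ofReal_add c.pLOS_nonneg (sub_nonneg.2 c.pLOS_le_one)]
    simp
  · simp

lemma stateProb_le_one (b : Bool) (x : EuclideanSpace ℝ (Fin 2)) : stateProb c b x ≤ 1 := by
  rw [← stateProb_add c x]
  cases b
  · exact le_add_self
  · exact le_self_add

/-- The intensity of the positions of the BSs in link state `b`. -/
def positionIntensity (b : Bool) : Measure (EuclideanSpace ℝ (Fin 2)) :=
  (ENNReal.ofReal c.lam • (volume : Measure (EuclideanSpace ℝ (Fin 2)))).withDensity (stateProb c b)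

lemma positionIntensity_le (b : Bool) :
    positionIntensity c b ≤
      ENNReal.ofReal c.lam • (volume : Measure (EuclideanSpace ℝ (Fin 2))) := by
  refine (withDensity_mono (g := 1) (Eventually.of_forall (stateProb_le_one c b))).trans ?_
  rw [withDensity_one]

instance {E : Type*} [MeasurableSpace E] (μ : Measure E) [SigmaFinite μ] (r : ℝ) :
    SigmaFinite (ENNReal.ofReal r • μ) :=
  inferInstanceAs (SigmaFinite (r.toNNReal • μ))

instance (b : Bool) : SigmaFinite (positionIntensity c b) :=
  SigmaFinite.withDensity_of_ne_top
    (Eventually.of_forall fun x => ((stateProb_le_one c b x).trans_lt ENNReal.one_lt_top).ne)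

lemma linkIntensity_eq (b : Bool) : linkIntensity c b =
    (positionIntensity c b).prod ((Measure.dirac b).prod (gaussianReal 0 (c.xi b ^ 2))) := rfl

instance (b : Bool) : SigmaFinite (linkIntensity c b) := by
  rw [linkIntensity_eq]
  infer_instance

lemma lintegral_linkIntensity (b : Bool) {f : Link → ℝ≥0∞} (hf : Measurable f) :
    ∫⁻ y, f y ∂linkIntensity c b =
      ∫⁻ z, ∫⁻ x, f (x, b, z) ∂positionIntensity c b ∂gaussianReal 0 (c.xi b ^ 2) := by
  rw [linkIntensity_eq, lintegral_prod_symm' _ hf,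
    lintegral_prod _ (Measurable.lintegral_prod_left' hf).aemeasurable, lintegral_dirac]

lemma lintegral_linkIntensity_congr (b : Bool) {f : Bool → Link → ℝ≥0∞}
    (hf : ∀ b, Measurable (f b)) :
    ∫⁻ y, f y.2.1 y ∂linkIntensity c b = ∫⁻ y, f b y ∂linkIntensity c b := by
  rw [lintegral_linkIntensity c b (measurable_comp_countable hf (by fun_prop)),
    lintegral_linkIntensity c b (hf b)]

lemma linkIntensity_apply (b : Bool) {A : Set Link} (hA : MeasurableSet A) :
    linkIntensity c b A =
      ∫⁻ z, positionIntensity c b {x | (x, b, z) ∈ A} ∂gaussianReal 0 (c.xi b ^ 2) := by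
  rw [← lintegral_indicator_one hA, lintegral_linkIntensity c b (measurable_one.indicator hA)]
  refine lintegral_congr fun z => ?_
  exact lintegral_indicator_one ((by fun_prop :
    Measurable fun x : EuclideanSpace ℝ (Fin 2) => ((x, b, z) : Link)) hA)

/-- The distance at which a link in state `b` with shadowing `z` has path loss `R`. -/
def lossRadius (b : Bool) (z R : ℝ) : ℝ :=
  10 ^ ((10 * Real.logb 10 R - c.beta - z) / (10 * c.alpha b))

lemma lossRadius_pos (b : Bool) (z R : ℝ) : 0 < lossRadius c b z R :=
  Real.rpow_pos_of_pos (by norm_num) _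

lemma lossRadius_mono (b : Bool) (z : ℝ) {R R' : ℝ} (hR : 0 < R) (h : R ≤ R') :
    lossRadius c b z R ≤ lossRadius c b z R' := by
  have h_alpha := c.alpha_pos b
  have h_log : Real.logb 10 R ≤ Real.logb 10 R' := Real.logb_le_logb_of_le (by norm_num) hR h
  exact Real.rpow_le_rpow_of_exponent_le (by norm_num) (by gcongr)

lemma lossRadius_pathLoss (b : Bool) (z : ℝ) {x : EuclideanSpace ℝ (Fin 2)} (hx : x ≠ 0) :
    lossRadius c b z (pathLoss c (x, b, z)) = ‖x‖ := by
  have h_alpha := c.alpha_pos b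
  have h_exponent : (10 * Real.logb 10 (pathLoss c (x, b, z)) - c.beta - z) / (10 * c.alpha b) =
      Real.logb 10 ‖x‖ := by
    rw [pathLoss, Real.logb_rpow (by norm_num) (by norm_num), pathLossDB]
    field_simp
    ring
  rw [lossRadius, h_exponent, Real.rpow_logb (by norm_num) (by norm_num) (norm_pos_iff.2 hx)]

lemma volume_closedBall_lossRadius (b : Bool) (z R : ℝ) :
    volume (Metric.closedBall (0 : EuclideanSpace ℝ (Fin 2)) (lossRadius c b z R)) =
      volume (Metric.ball (0 : EuclideanSpace ℝ (Fin 2)) 1) *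
        ENNReal.ofReal (lossRadius c b 0 R ^ 2 *
          Real.exp (-(Real.log 10 / (5 * c.alpha b)) * z)) := by
  have h_alpha := c.alpha_pos b
  rw [Measure.addHaar_closedBall _ _ (lossRadius_pos c b z R).le, finrank_euclideanSpace,
    Fintype.card_fin, mul_comm]
  congr 2
  rw [lossRadius, lossRadius, Real.rpow_def_of_pos (by norm_num),
    Real.rpow_def_of_pos (by norm_num), ← Real.exp_nat_mul, ← Real.exp_nat_mul, ← Real.exp_add]
  congr 1
  push_cast
  field_simp
  ring

lemma positionIntensity_pathLoss_le (b : Bool) (z R : ℝ) :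
    positionIntensity c b {x | pathLoss c (x, b, z) ≤ R} ≤ ENNReal.ofReal c.lam *
      volume (Metric.closedBall (0 : EuclideanSpace ℝ (Fin 2)) (lossRadius c b z R)) := by
  refine (positionIntensity_le c b _).trans ?_
  rw [Measure.smul_apply, smul_eq_mul]
  gcongr
  intro x hx
  rw [mem_closedBall_zero_iff]
  rcases eq_or_ne x 0 with rfl | hx₀
  · simpa using (lossRadius_pos c b z R).le
  · exact (lossRadius_pathLoss c b z hx₀).symm.trans_le
      (lossRadius_mono c b z (pathLoss_pos c _) hx)

-- The Gaussian shadowing has exponential moments.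
lemma linkIntensity_le_ne_top (b : Bool) (R : ℝ) :
    linkIntensity c b {y | pathLoss c y ≤ R} ≠ ∞ := by
  rw [linkIntensity_apply c b (measurableSet_le (measurable_pathLoss c) measurable_const)]
  refine ((lintegral_mono fun z => positionIntensity_pathLoss_le c b z R).trans_lt ?_).ne
  simp_rw [volume_closedBall_lossRadius]
  rw [lintegral_const_mul _ (by fun_prop), lintegral_const_mul _ (by fun_prop)]
  exact ENNReal.mul_lt_top ENNReal.ofReal_lt_top (ENNReal.mul_lt_top measure_ball_lt_top
    ((integrable_exp_mul_gaussianReal _).const_mul _).lintegral_lt_top)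

lemma positionIntensity_pathLoss_eq (b : Bool) (z t : ℝ) :
    positionIntensity c b {x | pathLoss c (x, b, z) = t} = 0 := by
  have h_sphere : {x | pathLoss c (x, b, z) = t} ⊆
      {0} ∪ Metric.sphere (0 : EuclideanSpace ℝ (Fin 2)) (lossRadius c b z t) := by
    rintro x rfl
    exact or_iff_not_imp_left.2 fun hx =>
      mem_sphere_zero_iff_norm.2 (lossRadius_pathLoss c b z hx).symm
  refine le_antisymm ((positionIntensity_le c b _).trans_eq ?_) zero_le
  rw [Measure.smul_apply, measure_mono_null h_sphere
    (measure_union_null (measure_singleton _) (Measure.addHaar_sphere _ _ _)), smul_zero]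

lemma linkIntensity_pathLoss_eq (b : Bool) (t : ℝ) :
    linkIntensity c b {y | pathLoss c y = t} = 0 := by
  rw [linkIntensity_apply c b (measurableSet_eq_fun (measurable_pathLoss c) measurable_const)]
  exact lintegral_eq_zero_of_ae_eq_zero
    (Eventually.of_forall fun z => positionIntensity_pathLoss_eq c b z t)

lemma linkIntensity_univ :
    linkIntensity c true Set.univ + linkIntensity c false Set.univ = ∞ := by
  have h_position b : linkIntensity c b Set.univ = positionIntensity c b Set.univ := by
    rw [linkIntensity_apply c b MeasurableSet.univ]
    simp
  rw [h_position, h_position, positionIntensity, positionIntensity,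
    withDensity_apply _ MeasurableSet.univ, withDensity_apply _ MeasurableSet.univ,
    Measure.restrict_univ, ← lintegral_add_left (measurable_stateProb c true)]
  simp_rw [stateProb_add]
  rw [lintegral_one, Measure.smul_apply, smul_eq_mul, measure_univ_of_isAddLeftInvariant]
  exact ENNReal.mul_top (by simpa using c.lam_pos)

end LinkIntensity

section StationIntensity

variable {NBS NUE : ℕ} (c : Params NBS NUE)

instance : IsProbabilityMeasure complexNormal :=
  Measure.isProbabilityMeasure_map
    Complex.equivRealProdCLM.symm.continuous.measurable.aemeasurable

instance : IsProbabilityMeasure (anglesLaw c) := by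
  rw [anglesLaw]
  infer_instance

/-- The law of the marks of a BS, apart from its link. -/
def markLaw : Measure (ℕ × (ℕ → ℂ) × Angles NBS NUE) :=
  c.pU.toMeasure.prod ((Measure.infinitePi fun _ : ℕ => complexNormal).prod (anglesLaw c))

instance : IsProbabilityMeasure (markLaw c) := by
  rw [markLaw]
  infer_instance

lemma stationIntensity_eq :
    stationIntensity c = (linkIntensity c true + linkIntensity c false).prod (markLaw c) := rfl

instance : SigmaFinite (stationIntensity c) := by
  rw [stationIntensity_eq]
  infer_instance

lemma lintegral_stationIntensity {f : Station NBS NUE → ℝ≥0∞} (hf : Measurable f) :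
    ∫⁻ y, f y ∂stationIntensity c =
      ∫⁻ x, ∫⁻ m, f (x, m) ∂markLaw c ∂linkIntensity c true +
        ∫⁻ x, ∫⁻ m, f (x, m) ∂markLaw c ∂linkIntensity c false := by
  rw [stationIntensity_eq, lintegral_prod _ hf.aemeasurable, lintegral_add_measure]

lemma stationIntensity_link (A : Set Link) :
    stationIntensity c {y | y.1 ∈ A} = linkIntensity c true A + linkIntensity c false A := by
  have h_prod : {y : Station NBS NUE | y.1 ∈ A} = A ×ˢ Set.univ := Set.prod_univ.symm
  rw [stationIntensity_eq, h_prod, Measure.prod_prod, measure_univ, mul_one, Measure.add_apply]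

lemma stationIntensity_le_ne_top (R : ℝ) :
    stationIntensity c {y | pathLoss c y.1 ≤ R} ≠ ∞ :=
  (stationIntensity_link c {y | pathLoss c y ≤ R}).trans_ne (ENNReal.add_ne_top.2
    ⟨linkIntensity_le_ne_top c true R, linkIntensity_le_ne_top c false R⟩)

lemma stationIntensity_pathLoss_eq (t : ℝ) : stationIntensity c {y | pathLoss c y.1 = t} = 0 :=
  (stationIntensity_link c {y | pathLoss c y = t}).trans
    (by rw [linkIntensity_pathLoss_eq, linkIntensity_pathLoss_eq, add_zero])

lemma stationIntensity_univ : stationIntensity c Set.univ = ∞ :=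
  (stationIntensity_link c Set.univ).trans (linkIntensity_univ c)

end StationIntensity

section ConditionalLaplace

variable {NBS NUE : ℕ} {c : Params NBS NUE}

/-- The Laplace functional at `s` of the interference of the BSs with path loss beyond `l`, when
the AOA of the service link is `φ₀`. -/
def laplaceBeyond (c : Params NBS NUE) (s : ℝ) (φ₀ : Fin NUE) (l : ℝ) : ℝ≥0∞ :=
  expNeg (∫⁻ y in {y | l < pathLoss c y.1}, 1 - expNeg (ENNReal.ofReal (s * power c φ₀ y))
    ∂stationIntensity c)

lemma measurable_laplaceBeyond (s : ℝ) (φ₀ : Fin NUE) : Measurable (laplaceBeyond c s φ₀) :=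
  measurable_expNeg.comp
    (measurable_setLIntegral_lt _ (fun y : Station NBS NUE => pathLoss c y.1) _)

namespace IsNetwork

variable {Ω : Type*} [MeasurableSpace Ω] {P : Measure Ω}
  {Φ : Ω → Set (Station NBS NUE)} {φ₀ : Ω → Fin NUE}

lemma processSigma_le (h : IsNetwork P c Φ φ₀) : processSigma Φ ≤ ‹MeasurableSpace Ω› :=
  iSup_le fun A => (h.poisson.measurable_count A.1 A.2).comap_le

lemma measurableSet_aoa (h : IsNetwork P c Φ φ₀) (i : Fin NUE) : MeasurableSet (φ₀ ⁻¹' {i}) :=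
  h.measurable_aoa (measurableSet_singleton i)

lemma ae_injOn_and_exists_isServing (h : IsNetwork P c Φ φ₀) : ∀ᵐ ω ∂P,
    Set.InjOn (fun y => pathLoss c y.1) (Φ ω) ∧ ∃ x, IsServing c (Φ ω) x := by
  have h_loss : Measurable fun y : Station NBS NUE => pathLoss c y.1 := by fun_prop
  have h_finite (R : ℕ) := h.poisson.ae_count_ne_top
    (measurableSet_le h_loss (measurable_const (a := (R : ℝ)))) (stationIntensity_le_ne_top c R)
  filter_upwards [h.poisson.ae_injOn h_loss (stationIntensity_le_ne_top c)
    (stationIntensity_pathLoss_eq c), h.poisson.ae_nonempty (stationIntensity_univ c),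
    ae_all_iff.2 h_finite] with ω h_inj h_nonempty h_fin
  exact ⟨h_inj, exists_isServing h_nonempty h_fin⟩

lemma aemeasurable_servingLoss (h : IsNetwork P c Φ φ₀) :
    AEMeasurable (fun ω => servingLoss c (Φ ω)) P := by
  refine NullMeasurable.aemeasurable
    (@measurable_of_Ioi ℝ (NullMeasurableSpace Ω P) _ _ _ _ _ _ _ _ fun u => ?_)
  have h_void : MeasurableSet {ω | count (Φ ω) {y | pathLoss c y.1 ≤ u} = 0} :=
    h.poisson.measurable_count _ (measurableSet_le (by fun_prop) measurable_const)
      (measurableSet_singleton 0)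
  refine NullMeasurableSet.congr h_void.nullMeasurableSet ?_
  filter_upwards [h.ae_injOn_and_exists_isServing] with ω hω
  exact propext (lt_servingLoss_iff hω.1 hω.2 u).symm

/-- A measurable version of the path loss on the service link. -/
def lossVersion (h : IsNetwork P c Φ φ₀) : Ω → ℝ := h.aemeasurable_servingLoss.mk _

lemma measurable_lossVersion (h : IsNetwork P c Φ φ₀) : Measurable h.lossVersion :=
  h.aemeasurable_servingLoss.measurable_mk

lemma servingLoss_ae_eq_lossVersion (h : IsNetwork P c Φ φ₀) :
    (fun ω => servingLoss c (Φ ω)) =ᵐ[P] h.lossVersion :=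
  h.aemeasurable_servingLoss.ae_eq_mk

lemma isFirstValue_lossVersion (h : IsNetwork P c Φ φ₀) :
    IsFirstValue P (fun ω => pointMeasure (Φ ω)) (fun y => pathLoss c y.1) h.lossVersion := by
  filter_upwards [h.ae_injOn_and_exists_isServing, h.servingLoss_ae_eq_lossVersion] with ω hω hL u
  rw [← hL, lt_servingLoss_iff hω.1 hω.2 u, pointMeasure_apply _
    (measurableSet_le (by fun_prop) measurable_const), ENat.toENNReal_eq_zero]

lemma ae_interference_eq (h : IsNetwork P c Φ φ₀) : ∀ᵐ ω ∂P,
    interference c (Φ ω) (φ₀ ω) = ∫⁻ y in {y | h.lossVersion ω < pathLoss c y.1},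
      ENNReal.ofReal (power c (φ₀ ω) y) ∂(pointMeasure (Φ ω)) := by
  filter_upwards [h.ae_injOn_and_exists_isServing, h.servingLoss_ae_eq_lossVersion] with ω hω hL
  rw [interference_eq c hω.1 hω.2, ← hL]

lemma aemeasurable_interference (h : IsNetwork P c Φ φ₀) :
    AEMeasurable (fun ω => interference c (Φ ω) (φ₀ ω)) P := by
  have h_loss : Measurable fun y : Station NBS NUE => pathLoss c y.1 := by fun_prop
  refine AEMeasurable.congr ?_ (h.ae_interference_eq.mono fun ω h => h.symm)
  refine aemeasurable_of_tendsto_metrizable_ae' (f := fun n ω =>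
    ∫⁻ y in {y | dyadicCeil n (h.lossVersion ω) < pathLoss c y.1},
      ENNReal.ofReal (power c (φ₀ ω) y) ∂(pointMeasure (Φ ω))) (fun n => ?_)
    (Eventually.of_forall fun ω => tendsto_setLIntegral_dyadicCeil_lt h_loss _ _)
  exact (measurable_comp_countable (fun i => measurable_setLIntegral_beyond_dyadicCeil
    (f := fun y => ENNReal.ofReal (power c i y))
    (measurable_pointMeasure h.poisson.measurable_count)
    h_loss h.measurable_lossVersion (by fun_prop) n) h.measurable_aoa).aemeasurable

variable [IsProbabilityMeasure P]

lemma hasPoissonLaplace_restrict (h : IsNetwork P c Φ φ₀) (i : Fin NUE) :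
    HasPoissonLaplace (P.restrict (φ₀ ⁻¹' {i})) (fun ω => pointMeasure (Φ ω))
      (stationIntensity c) := by
  intro g hg
  have h_process : Measurable[processSigma Φ] fun ω => pointMeasure (Φ ω) :=
    measurable_pointMeasure fun A hA => (comap_measurable _).mono
      (le_iSup (fun A : {A : Set (Station NBS NUE) // MeasurableSet A} =>
        MeasurableSpace.comap (fun ω => count (Φ ω) A.1) inferInstance) ⟨A, hA⟩) le_rfl
  have h_aoa : Measurable[MeasurableSpace.comap φ₀ inferInstance]
      ((φ₀ ⁻¹' {i}).indicator (1 : Ω → ℝ≥0∞)) :=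
    (measurable_of_countable (({i} : Set (Fin NUE)).indicator (1 : Fin NUE → ℝ≥0∞))).comp
      (comap_measurable φ₀)
  have h_indep := lintegral_mul_eq_lintegral_mul_lintegral_of_independent_measurableSpace
    h.processSigma_le h.measurable_aoa.comap_le h.indep
    (measurable_expNeg.comp ((Measure.measurable_lintegral hg).comp h_process)) h_aoa
  simp only [Function.comp_def] at h_indep
  rw [h.poisson.hasPoissonLaplace g hg, measure_univ, one_mul,
    lintegral_indicator_one (h.measurableSet_aoa i)] at h_indep
  rw [Measure.restrict_apply_univ, mul_comm, ← h_indep,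
    ← lintegral_indicator (h.measurableSet_aoa i)]
  refine lintegral_congr fun ω => ?_
  by_cases hω : ω ∈ φ₀ ⁻¹' {i} <;> simp [hω]

lemma map_lossVersion_restrict (h : IsNetwork P c Φ φ₀) (i : Fin NUE) :
    (P.restrict (φ₀ ⁻¹' {i})).map h.lossVersion = c.qUE i • P.map h.lossVersion := by
  have hL := h.measurable_lossVersion
  have h_loss : Measurable fun y : Station NBS NUE => pathLoss c y.1 := by fun_prop
  have h_aoa : P (φ₀ ⁻¹' {i}) = c.qUE i := by
    rw [← Measure.map_apply h.measurable_aoa (measurableSet_singleton i), h.law_aoa,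
      PMF.toMeasure_apply_singleton _ _ (measurableSet_singleton i)]
  have : IsFiniteMeasure (c.qUE i • P.map h.lossVersion) :=
    Measure.smul_finite _ (c.qUE.apply_ne_top i)
  refine measure_ext_of_Ioi fun r => ?_
  have h_cond := measure_lt_first (h.hasPoissonLaplace_restrict i) h_loss hL
    (ae_restrict_of_ae h.isFirstValue_lossVersion) r
  have h_uncond := measure_lt_first h.poisson.hasPoissonLaplace h_loss hL
    h.isFirstValue_lossVersion r
  rw [measure_univ, one_mul] at h_uncond
  rw [Measure.restrict_apply_univ, h_aoa, ← h_uncond] at h_cond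
  rw [Measure.smul_apply, Measure.map_apply hL measurableSet_Ioi,
    Measure.map_apply hL measurableSet_Ioi, smul_eq_mul]
  exact h_cond

lemma setLIntegral_expNeg_interference_inter (h : IsNetwork P c Φ φ₀) {s : ℝ} (hs : 0 ≤ s)
    {B : Set ℝ} (hB : MeasurableSet B) (i : Fin NUE) :
    ∫⁻ ω in φ₀ ⁻¹' {i} ∩ h.lossVersion ⁻¹' B,
      expNeg (ENNReal.ofReal s * interference c (Φ ω) (φ₀ ω)) ∂P =
    c.qUE i * ∫⁻ l in B, laplaceBeyond c s i l ∂(P.map h.lossVersion) := by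
  have hLB := h.measurable_lossVersion hB
  have h_power : ∀ᵐ ω ∂P.restrict (φ₀ ⁻¹' {i} ∩ h.lossVersion ⁻¹' B),
      expNeg (ENNReal.ofReal s * interference c (Φ ω) (φ₀ ω)) =
        expNeg (∫⁻ y in {y | h.lossVersion ω < pathLoss c y.1},
          ENNReal.ofReal (s * power c i y) ∂(pointMeasure (Φ ω))) := by
    filter_upwards [ae_restrict_of_ae h.ae_interference_eq,
      ae_restrict_mem ((h.measurableSet_aoa i).inter hLB)] with ω hω hωi
    simp_rw [hω, show φ₀ ω = i from hωi.1, ENNReal.ofReal_mul hs]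
    rw [lintegral_const_mul _ (by fun_prop)]
  rw [lintegral_congr_ae h_power, Set.inter_comm, ← Measure.restrict_restrict hLB,
    setLIntegral_beyond_first (h.hasPoissonLaplace_restrict i)
      (measurable_pointMeasure h.poisson.measurable_count) (by fun_prop) h.measurable_lossVersion
      (ae_restrict_of_ae h.isFirstValue_lossVersion) (by fun_prop) hB,
    h.map_lossVersion_restrict i, Measure.restrict_smul, lintegral_smul_measure, smul_eq_mul]
  rfl

lemma setLIntegral_expNeg_interference (h : IsNetwork P c Φ φ₀) {s : ℝ} (hs : 0 ≤ s)
    {B : Set ℝ} (hB : MeasurableSet B) :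
    ∫⁻ ω in h.lossVersion ⁻¹' B, expNeg (ENNReal.ofReal s * interference c (Φ ω) (φ₀ ω)) ∂P =
      ∫⁻ l in B, ∑ i, c.qUE i * laplaceBeyond c s i l ∂(P.map h.lossVersion) := by
  have h_union : ⋃ i, φ₀ ⁻¹' {i} = Set.univ := Set.iUnion_eq_univ_iff.2 fun ω => ⟨φ₀ ω, rfl⟩
  rw [lintegral_finsetSum _ fun i _ => (measurable_laplaceBeyond s i).const_mul _]
  simp_rw [lintegral_const_mul _ (measurable_laplaceBeyond (c := c) s _),
    ← h.setLIntegral_expNeg_interference_inter hs hB]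
  rw [← setLIntegral_univ, ← h_union,
    lintegral_iUnion h.measurableSet_aoa (pairwise_disjoint_fiber φ₀), tsum_fintype]
  simp_rw [Measure.restrict_restrict (h.measurableSet_aoa _)]

theorem condLaplace_ae_eq (h : IsNetwork P c Φ φ₀) {s : ℝ} (hs : 0 ≤ s) :
    ∀ᵐ l ∂(P.map fun ω => servingLoss c (Φ ω)),
      condLaplace P c Φ φ₀ s l = ∑ i, c.qUE i * laplaceBeyond c s i l := by
  have h_exp : Measurable fun x : ℝ × ℝ≥0∞ => expNeg (ENNReal.ofReal s * x.2) := by fun_prop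
  have : IsProbabilityMeasure (P.map fun ω => servingLoss c (Φ ω)) :=
    Measure.isProbabilityMeasure_map h.aemeasurable_servingLoss
  refine ae_eq_of_forall_setLIntegral_eq_of_sigmaFinite
    (Measurable.lintegral_kernel (f := fun i => expNeg (ENNReal.ofReal s * i)) (by fun_prop))
    (Finset.measurable_fun_sum _ fun i _ => (measurable_laplaceBeyond s i).const_mul _)
    fun B hB _ => ?_
  have h_joint := Measure.setLIntegral_compProd (μ := P.map fun ω => servingLoss c (Φ ω))
    (κ := condDistrib (fun ω => interference c (Φ ω) (φ₀ ω)) (fun ω => servingLoss c (Φ ω)) P)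
    h_exp hB MeasurableSet.univ
  simp only [Measure.restrict_univ] at h_joint
  conv_rhs => rw [Measure.map_congr h.servingLoss_ae_eq_lossVersion]
  rw [← h.setLIntegral_expNeg_interference hs hB]
  refine h_joint.symm.trans ?_
  rw [compProd_map_condDistrib h.aemeasurable_interference,
    ← lintegral_indicator (hB.prod MeasurableSet.univ),
    lintegral_map' (h_exp.indicator (hB.prod MeasurableSet.univ)).aemeasurable
      (h.aemeasurable_servingLoss.prodMk h.aemeasurable_interference),
    ← lintegral_indicator (h.measurable_lossVersion hB)]
  refine lintegral_congr_ae (h.servingLoss_ae_eq_lossVersion.mono fun ω hω => ?_)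
  dsimp only at hω ⊢
  by_cases hb : h.lossVersion ω ∈ B <;> simp [hω, hb]

end IsNetwork

end ConditionalLaplace

section Fading

lemma measurable_complex_mk : Measurable fun z : ℝ × ℝ => (⟨z.1, z.2⟩ : ℂ) :=
  Complex.equivRealProdCLM.symm.continuous.measurable

lemma integral_exp_sq_gaussianReal {v : ℝ} (hv : 0 ≤ v) :
    ∫ x, Real.exp (-(v * x ^ 2)) ∂(gaussianReal 0 (1 / 2)) = √(1 + v)⁻¹ := by
  have h_density (x : ℝ) : gaussianPDFReal 0 (1 / 2) x • Real.exp (-(v * x ^ 2)) =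
      (√Real.pi)⁻¹ * Real.exp (-(1 + v) * x ^ 2) := by
    have h_norm : 2 * Real.pi * ((1 / 2 : ℝ≥0) : ℝ) = Real.pi := by push_cast; ring
    have h_exponent : -(x - 0) ^ 2 / (2 * ((1 / 2 : ℝ≥0) : ℝ)) + -(v * x ^ 2) =
        -(1 + v) * x ^ 2 := by push_cast; ring
    rw [gaussianPDFReal, smul_eq_mul, mul_assoc, ← Real.exp_add, h_norm, h_exponent]
  simp_rw [integral_gaussianReal_eq_integral_smul (show (1 / 2 : ℝ≥0) ≠ 0 by norm_num), h_density]
  rw [integral_const_mul, integral_gaussian, ← Real.sqrt_inv, ← Real.sqrt_mul (by positivity)]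
  congr 1
  field_simp

lemma lintegral_exp_sq_gaussianReal {v : ℝ} (hv : 0 ≤ v) :
    ∫⁻ x, ENNReal.ofReal (Real.exp (-(v * x ^ 2))) ∂(gaussianReal 0 (1 / 2)) =
      ENNReal.ofReal (√(1 + v)⁻¹) := by
  rw [← integral_exp_sq_gaussianReal hv, ofReal_integral_eq_lintegral_ofReal _
    (Eventually.of_forall fun x => (Real.exp_pos _).le)]
  refine Integrable.of_bound (C := 1) (by fun_prop) (Eventually.of_forall fun x => ?_)
  rw [Real.norm_of_nonneg (Real.exp_pos _).le, Real.exp_le_one_iff, neg_nonpos]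
  positivity

lemma lintegral_expNeg_complexNormal {v : ℝ} (hv : 0 ≤ v) :
    ∫⁻ z, expNeg (ENNReal.ofReal (v * ‖z‖ ^ 2)) ∂complexNormal = ENNReal.ofReal (1 + v)⁻¹ := by
  have h_split (z : ℝ × ℝ) : expNeg (ENNReal.ofReal (v * ‖(⟨z.1, z.2⟩ : ℂ)‖ ^ 2)) =
      ENNReal.ofReal (Real.exp (-(v * z.1 ^ 2))) * ENNReal.ofReal (Real.exp (-(v * z.2 ^ 2))) := by
    rw [expNeg_ofReal (by positivity), ← ENNReal.ofReal_mul (Real.exp_pos _).le, ← Real.exp_add,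
      ← Complex.normSq_eq_norm_sq, Complex.normSq_mk]
    congr 2
    ring
  have h_meas : AEMeasurable (fun x : ℝ => ENNReal.ofReal (Real.exp (-(v * x ^ 2))))
      (gaussianReal 0 (1 / 2)) := by fun_prop
  rw [complexNormal, lintegral_map (by fun_prop) measurable_complex_mk]
  simp_rw [h_split]
  rw [lintegral_prod_mul h_meas h_meas, lintegral_exp_sq_gaussianReal hv,
    ← ENNReal.ofReal_mul (by positivity), Real.mul_self_sqrt (by positivity)]

lemma charFun_complexNormal (t : ℂ) :
    charFun complexNormal t = Complex.exp (-(‖t‖ ^ 2 / 4 : ℝ)) := by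
  have h_split (z : ℝ × ℝ) : Complex.exp ((inner ℝ (⟨z.1, z.2⟩ : ℂ) t : ℝ) * Complex.I) =
      Complex.exp (t.re * z.1 * Complex.I) * Complex.exp (t.im * z.2 * Complex.I) := by
    rw [← Complex.exp_add, Complex.inner]
    congr 1
    simp
    ring
  rw [charFun_apply, complexNormal, integral_map measurable_complex_mk.aemeasurable
    (by fun_prop)]
  simp_rw [h_split]
  rw [integral_prod_mul (fun x : ℝ => Complex.exp (t.re * x * Complex.I))
    (fun x : ℝ => Complex.exp (t.im * x * Complex.I)), ← charFun_apply_real, ← charFun_apply_real,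
    charFun_gaussianReal, charFun_gaussianReal, ← Complex.exp_add, ← Complex.normSq_eq_norm_sq,
    Complex.normSq_apply]
  congr 1
  push_cast
  ring

lemma charFun_map_smul_complexNormal (r : ℝ) (t : ℂ) :
    charFun (complexNormal.map fun z => r • z) t =
      Complex.exp (-(r ^ 2 * ‖t‖ ^ 2 / 4 : ℝ)) := by
  rw [charFun_map_smul, charFun_complexNormal, norm_smul, mul_pow, Real.norm_eq_abs, sq_abs]

/-- The law of the small scale fading of the paths of a link: independent complex normal gains. -/
abbrev fadingLaw : Measure (ℕ → ℂ) := Measure.infinitePi fun _ : ℕ => complexNormal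

lemma map_eval_fadingLaw (j : ℕ) : fadingLaw.map (fun γ => γ j) = complexNormal :=
  (measurePreserving_eval_infinitePi (fun _ : ℕ => complexNormal) j).map_eq

lemma map_smul_eval_fadingLaw (r : ℝ) (j : ℕ) :
    fadingLaw.map (fun γ => r • γ j) = complexNormal.map fun z => r • z := by
  rw [← map_eval_fadingLaw j, Measure.map_map (by fun_prop) (by fun_prop)]
  rfl

lemma map_sum_fadingLaw (χ : ℕ → ℝ) (η : ℕ) :
    fadingLaw.map (fun γ => ∑ j ∈ Finset.range η, γ j * (χ j : ℂ)) =
      complexNormal.map (fun z => (√(∑ j ∈ Finset.range η, χ j ^ 2)) • z) := by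
  have h_indep : iIndepFun (fun (j : Fin η) (γ : ℕ → ℂ) => χ j • γ j) fadingLaw :=
    (iIndepFun_infinitePi (P := fun _ : ℕ => complexNormal) (X := fun j z => χ j • z)
      (fun j => by fun_prop)).precomp Fin.val_injective
  have h_sum : (fun γ : ℕ → ℂ => ∑ j ∈ Finset.range η, γ j * (χ j : ℂ)) =
      ∑ j : Fin η, fun γ : ℕ → ℂ => χ j • γ j := by
    ext γ
    rw [Finset.sum_range, Finset.sum_apply]
    exact Finset.sum_congr rfl fun j _ => by rw [Complex.real_smul, mul_comm]
  have : IsProbabilityMeasure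
      (fadingLaw.map fun γ => ∑ j ∈ Finset.range η, γ j * (χ j : ℂ)) :=
    Measure.isProbabilityMeasure_map (Measurable.aemeasurable (by fun_prop))
  have : IsProbabilityMeasure
      (complexNormal.map fun z => (√(∑ j ∈ Finset.range η, χ j ^ 2)) • z) :=
    Measure.isProbabilityMeasure_map (by fun_prop)
  refine Measure.ext_of_charFun ?_
  ext t
  rw [h_sum, h_indep.charFun_map_sum_eq_prod fun j => Measurable.aemeasurable (by fun_prop),
    Finset.prod_apply]
  simp_rw [map_smul_eval_fadingLaw, charFun_map_smul_complexNormal]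
  rw [Real.sq_sqrt (Finset.sum_nonneg fun j _ => sq_nonneg _), ← Complex.exp_sum,
    Finset.sum_range]
  congr 1
  push_cast
  rw [Finset.sum_neg_distrib, Finset.sum_mul, Finset.sum_div]

lemma lintegral_expNeg_norm_sum (χ : ℕ → ℝ) (η : ℕ) {v : ℝ} (hv : 0 ≤ v) :
    ∫⁻ γ, expNeg (ENNReal.ofReal (v * ‖∑ j ∈ Finset.range η, γ j * (χ j : ℂ)‖ ^ 2)) ∂fadingLaw =
      ENNReal.ofReal (1 + v * ∑ j ∈ Finset.range η, χ j ^ 2)⁻¹ := by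
  have h_meas : Measurable fun z : ℂ => expNeg (ENNReal.ofReal (v * ‖z‖ ^ 2)) := by fun_prop
  have h_var : 0 ≤ ∑ j ∈ Finset.range η, χ j ^ 2 := Finset.sum_nonneg fun j _ => sq_nonneg _
  rw [← lintegral_map (f := fun z : ℂ => expNeg (ENNReal.ofReal (v * ‖z‖ ^ 2)))
    (g := fun γ : ℕ → ℂ => ∑ j ∈ Finset.range η, γ j * (χ j : ℂ)) h_meas (by fun_prop),
    map_sum_fadingLaw, lintegral_map h_meas (by fun_prop)]
  simp_rw [norm_smul, mul_pow, Real.norm_eq_abs, sq_abs, Real.sq_sqrt h_var, ← mul_assoc]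
  exact lintegral_expNeg_complexNormal (mul_nonneg hv h_var)

lemma lintegral_expNeg_sum_norm (η : ℕ) {v : ℝ} (hv : 0 ≤ v) :
    ∫⁻ γ, expNeg (ENNReal.ofReal (v * ∑ j ∈ Finset.range η, ‖γ j‖ ^ 2)) ∂fadingLaw =
      ENNReal.ofReal ((1 + v) ^ η)⁻¹ := by
  have h_meas : Measurable fun z : ℂ => expNeg (ENNReal.ofReal (v * ‖z‖ ^ 2)) := by fun_prop
  have h_indep := iIndepFun_infinitePi (P := fun _ : ℕ => complexNormal)
    (X := fun _ z => expNeg (ENNReal.ofReal (v * ‖z‖ ^ 2))) fun _ => h_meas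
  have h_factor (j : ℕ) : ∫⁻ γ, expNeg (ENNReal.ofReal (v * ‖γ j‖ ^ 2)) ∂fadingLaw =
      ENNReal.ofReal (1 + v)⁻¹ := by
    rw [← lintegral_expNeg_complexNormal hv, ← map_eval_fadingLaw j,
      lintegral_map h_meas (measurable_pi_apply j)]
  simp_rw [Finset.mul_sum, ENNReal.ofReal_sum_of_nonneg fun _ _ =>
    mul_nonneg hv (sq_nonneg _), expNeg_sum]
  rw [lintegral_prod_eq_prod_lintegral_of_indepFun (Finset.range η) _ h_indep
    fun j => h_meas.comp (measurable_pi_apply j)]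
  simp_rw [h_factor]
  rw [Finset.prod_const, Finset.card_range, ← ENNReal.ofReal_pow (by positivity), inv_pow]

end Fading

section ElementaryBounds

lemma expNeg_sum_mul_le {ι : Type*} (t : Finset ι) {w : ι → ℝ≥0∞} (hw : ∑ i ∈ t, w i = 1)
    (e : ι → ℝ≥0∞) : expNeg (∑ i ∈ t, w i * e i) ≤ ∑ i ∈ t, w i * expNeg (e i) := by
  by_cases h_top : ∑ i ∈ t, w i * e i = ∞
  · simp [h_top, expNeg_top]
  have hw_top : ∀ i ∈ t, w i ≠ ∞ := ENNReal.sum_ne_top.1 (hw ▸ ENNReal.one_ne_top)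
  have h_mean : ∑ i ∈ t, w i * e i = ENNReal.ofReal (∑ i ∈ t, (w i).toReal * (e i).toReal) := by
    rw [ENNReal.ofReal_sum_of_nonneg fun i _ => by positivity]
    refine Finset.sum_congr rfl fun i hi => ?_
    rw [← ENNReal.toReal_mul, ENNReal.ofReal_toReal (ENNReal.sum_ne_top.1 h_top i hi)]
  have h_term : ∀ i ∈ t, ENNReal.ofReal ((w i).toReal * Real.exp (-(e i).toReal)) ≤
      w i * expNeg (e i) := by
    intro i hi
    rcases eq_or_ne (w i) 0 with h_zero | h_zero
    · simp [h_zero]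
    have he : e i ≠ ∞ := fun he =>
      ENNReal.sum_ne_top.1 h_top i hi (by rw [he, ENNReal.mul_top h_zero])
    rw [ENNReal.ofReal_mul ENNReal.toReal_nonneg, ENNReal.ofReal_toReal (hw_top i hi),
      ← expNeg_ofReal ENNReal.toReal_nonneg, ENNReal.ofReal_toReal he]
  have h_jensen := convexOn_exp.map_sum_le (w := fun i => (w i).toReal)
    (p := fun i => -(e i).toReal) (fun i _ => ENNReal.toReal_nonneg)
    (by rw [← ENNReal.toReal_sum hw_top, hw, ENNReal.toReal_one]) (fun i _ => Set.mem_univ _)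
  simp only [smul_eq_mul, mul_neg, Finset.sum_neg_distrib] at h_jensen
  rw [h_mean, expNeg_ofReal (Finset.sum_nonneg fun i _ => by positivity)]
  refine (ENNReal.ofReal_le_ofReal h_jensen).trans ?_
  rw [ENNReal.ofReal_sum_of_nonneg fun i _ => by positivity]
  exact Finset.sum_le_sum h_term

lemma one_sub_ofReal_inv_one_add {x : ℝ} (hx : 0 ≤ x) :
    1 - ENNReal.ofReal (1 + x)⁻¹ = 1 / (1 + (ENNReal.ofReal x)⁻¹) := by
  rcases hx.eq_or_lt with rfl | hx
  · simp
  rw [← ENNReal.ofReal_inv_of_pos hx, ← ENNReal.ofReal_one, ← ENNReal.ofReal_sub _ (by positivity),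
    ← ENNReal.ofReal_add zero_le_one (by positivity), ← ENNReal.ofReal_div_of_pos (by positivity)]
  congr 1
  field_simp
  ring

lemma lintegral_one_sub {α : Type*} [MeasurableSpace α] {μ : Measure α} [IsProbabilityMeasure μ]
    {f : α → ℝ≥0∞} (hf : Measurable f) (h_le : ∀ a, f a ≤ 1) :
    ∫⁻ a, 1 - f a ∂μ = 1 - ∫⁻ a, f a ∂μ := by
  rw [lintegral_sub hf ((lintegral_mono h_le).trans_lt (by simp)).ne (Eventually.of_forall h_le)]
  simp

lemma hasSum_pmf_toReal {α : Type*} (p : PMF α) : HasSum (fun a => (p a).toReal) 1 := by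
  have h_sum := ENNReal.hasSum_toReal (f := p) (p.tsum_coe ▸ ENNReal.one_ne_top)
  rwa [← ENNReal.tsum_toReal_eq p.apply_ne_top, p.tsum_coe, ENNReal.toReal_one] at h_sum

lemma summable_pmf_mul {α : Type*} (p : PMF α) {f : α → ℝ} (h_nonneg : ∀ a, 0 ≤ f a)
    (h_le : ∀ a, f a ≤ 1) : Summable fun a => (p a).toReal * f a :=
  (hasSum_pmf_toReal p).summable.of_nonneg_of_le
    (fun a => mul_nonneg ENNReal.toReal_nonneg (h_nonneg a))
    (fun a => mul_le_of_le_one_right ENNReal.toReal_nonneg (h_le a))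

lemma tsum_pmf_mul_ofReal_one_sub {α : Type*} (p : PMF α) {f : α → ℝ} (h_nonneg : ∀ a, 0 ≤ f a)
    (h_le : ∀ a, f a ≤ 1) :
    ∑' a, p a * ENNReal.ofReal (1 - f a) = ENNReal.ofReal (1 - ∑' a, (p a).toReal * f a) := by
  have h_sum : HasSum (fun a => (p a).toReal * (1 - f a)) (1 - ∑' a, (p a).toReal * f a) := by
    simpa only [mul_sub, mul_one] using
      (hasSum_pmf_toReal p).sub (summable_pmf_mul p h_nonneg h_le).hasSum
  rw [← h_sum.tsum_eq, ENNReal.ofReal_tsum_of_nonneg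
    (fun a => mul_nonneg ENNReal.toReal_nonneg (sub_nonneg.2 (h_le a))) h_sum.summable]
  refine tsum_congr fun a => ?_
  rw [ENNReal.ofReal_mul ENNReal.toReal_nonneg, ENNReal.ofReal_toReal (p.apply_ne_top a)]

lemma tsum_pmf_ite_eq_zero (p : PMF ℕ) : ∑' n, (if n = 0 then 0 else p n) = 1 - p 0 := by
  rw [← p.tsum_coe, ENNReal.tsum_eq_add_tsum_ite (f := p) 0,
    ENNReal.add_sub_cancel_left (p.apply_ne_top 0)]
  exact tsum_congr fun n => by split_ifs <;> rfl

lemma le_beamInner {n : ℕ} {ρ : ℝ} (hρ : ρ ≤ 1) (θ₁ θ₂ : Fin n) : ρ ≤ beamInner ρ θ₁ θ₂ := by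
  rw [beamInner]
  split_ifs
  exacts [hρ, le_rfl]

end ElementaryBounds

section FadingAverage

variable {NBS NUE : ℕ} (c : Params NBS NUE) (φ₀ : Fin NUE) (a : Angles NBS NUE) (η U : ℕ)

lemma gain_nonneg : 0 ≤ gain c := by
  have := c.power_pos
  rw [gain]
  positivity

lemma le_chi_sq (j w : ℕ) : c.rhoBS ^ 2 * c.rhoUE ^ 2 ≤ chi c φ₀ a j w ^ 2 := by
  have h_rhoBS := c.rhoBS_nonneg
  have h_rhoUE := c.rhoUE_nonneg
  have h_arrival := le_beamInner c.rhoUE_lt_one.le φ₀ (a.1 j)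
  have h_departure := le_beamInner c.rhoBS_lt_one.le (a.2.1 j) (a.2.2 w)
  rw [chi, ← mul_pow, mul_comm c.rhoBS]
  gcongr
  exact h_rhoUE.trans h_arrival

lemma le_sum_chi_sq (w : ℕ) :
    η * (c.rhoBS ^ 2 * c.rhoUE ^ 2) ≤ ∑ j ∈ Finset.range η, chi c φ₀ a j w ^ 2 := by
  simpa using Finset.card_nsmul_le_sum (Finset.range η) (fun j => chi c φ₀ a j w ^ 2) _
    fun j _ => le_chi_sq c φ₀ a j w

variable {s t : ℝ} {η U}

lemma lintegral_fading_beam_le (hs : 0 ≤ s) (ht : 0 < t) (hη : η ≠ 0) (w : ℕ) :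
    ∫⁻ γ, expNeg (ENNReal.ofReal (s * gain c * t⁻¹ / η *
      ‖∑ j ∈ Finset.range η, γ j * (chi c φ₀ a j w : ℂ)‖ ^ 2)) ∂fadingLaw ≤
      ENNReal.ofReal (1 + s * gain c * t⁻¹ * c.rhoBS ^ 2 * c.rhoUE ^ 2)⁻¹ := by
  have h_gain := gain_nonneg c
  rw [lintegral_expNeg_norm_sum (fun j => chi c φ₀ a j w) η (by positivity),
    show s * gain c * t⁻¹ * c.rhoBS ^ 2 * c.rhoUE ^ 2 =
      s * gain c * t⁻¹ / η * (η * (c.rhoBS ^ 2 * c.rhoUE ^ 2)) by field_simp]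
  gcongr
  exact le_sum_chi_sq c φ₀ a η w

/-- Jensen's inequality decouples the beams, which all share the fading of the link. -/
lemma lintegral_fading_le (hs : 0 ≤ s) (ht : 0 < t) (hη : η ≠ 0) (hU : U ≠ 0) :
    ∫⁻ γ, expNeg (ENNReal.ofReal (scaledPower c φ₀ s η U t γ a)) ∂fadingLaw ≤
      ENNReal.ofReal (1 + s * gain c * t⁻¹ * c.rhoBS ^ 2 * c.rhoUE ^ 2)⁻¹ := by
  have h_gain := gain_nonneg c
  set beamPower : ℕ → (ℕ → ℂ) → ℝ := fun w γ =>
    s * gain c * t⁻¹ / η * ‖∑ j ∈ Finset.range η, γ j * (chi c φ₀ a j w : ℂ)‖ ^ 2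
  have h_weights : ∑ _w ∈ Finset.range U, (U : ℝ≥0∞)⁻¹ = 1 := by
    rw [Finset.sum_const, Finset.card_range, nsmul_eq_mul,
      ENNReal.mul_inv_cancel (by exact_mod_cast hU) (ENNReal.natCast_ne_top U)]
  have h_mean (γ : ℕ → ℂ) : ENNReal.ofReal (scaledPower c φ₀ s η U t γ a) =
      ∑ w ∈ Finset.range U, (U : ℝ≥0∞)⁻¹ * ENNReal.ofReal (beamPower w γ) := by
    rw [← Finset.mul_sum, ← ENNReal.ofReal_sum_of_nonneg fun w _ => by positivity,
      ← ENNReal.ofReal_natCast, ← ENNReal.ofReal_inv_of_pos (by positivity),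
      ← ENNReal.ofReal_mul (by positivity), ← Finset.mul_sum, scaledPower]
    congr 1
    field_simp
  calc ∫⁻ γ, expNeg (ENNReal.ofReal (scaledPower c φ₀ s η U t γ a)) ∂fadingLaw
      ≤ ∫⁻ γ, ∑ w ∈ Finset.range U,
          (U : ℝ≥0∞)⁻¹ * expNeg (ENNReal.ofReal (beamPower w γ)) ∂fadingLaw :=
        lintegral_mono fun γ => by
          simpa only [h_mean] using expNeg_sum_mul_le _ h_weights _
    _ = ∑ w ∈ Finset.range U,
          (U : ℝ≥0∞)⁻¹ * ∫⁻ γ, expNeg (ENNReal.ofReal (beamPower w γ)) ∂fadingLaw := by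
        rw [lintegral_finsetSum _ fun w _ => by fun_prop]
        exact Finset.sum_congr rfl fun w _ => lintegral_const_mul _ (by fun_prop)
    _ ≤ ∑ w ∈ Finset.range U, (U : ℝ≥0∞)⁻¹ *
          ENNReal.ofReal (1 + s * gain c * t⁻¹ * c.rhoBS ^ 2 * c.rhoUE ^ 2)⁻¹ := by
        gcongr with w
        exact lintegral_fading_beam_le c φ₀ a hs ht hη w
    _ = _ := by rw [← Finset.sum_mul, h_weights, one_mul]

/-- The integrand `(1 + s G t⁻¹ / (η U) · ∑_w ∑_j χ_{j,w}²)^{-η}` of `PsiCS`. -/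
def psiIntegrand (s : ℝ) (η U : ℕ) (t : ℝ) (z : Fin NUE × Angles NBS NUE) : ℝ :=
  ((1 + s * gain c * t⁻¹ / (η * U) *
      ∑ w ∈ Finset.range U, ∑ j ∈ Finset.range η, chi c z.1 z.2 j w ^ 2) ^ η)⁻¹

/-- By the Cauchy–Schwarz inequality the power of every beam is at most `∑ χ_j² ∑ |γ_j|²`, in which
the fading of the link is a common factor. -/
lemma ofReal_psiIntegrand_le (hs : 0 ≤ s) (ht : 0 < t) :
    ENNReal.ofReal (psiIntegrand c s η U t (φ₀, a)) ≤
      ∫⁻ γ, expNeg (ENNReal.ofReal (scaledPower c φ₀ s η U t γ a)) ∂fadingLaw := by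
  have h_gain := gain_nonneg c
  rw [psiIntegrand, ← lintegral_expNeg_sum_norm η (by positivity)]
  refine lintegral_mono fun γ => expNeg_antitone (ENNReal.ofReal_le_ofReal ?_)
  rw [scaledPower, mul_assoc (s * gain c * t⁻¹ / (η * U)), Finset.sum_mul]
  gcongr with w
  calc ‖∑ j ∈ Finset.range η, γ j * (chi c φ₀ a j w : ℂ)‖ ^ 2
      ≤ (∑ j ∈ Finset.range η, |chi c φ₀ a j w| * ‖γ j‖) ^ 2 := by
        gcongr
        refine (norm_sum_le _ _).trans (le_of_eq (Finset.sum_congr rfl fun j _ => ?_))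
        rw [norm_mul, Complex.norm_real, Real.norm_eq_abs, mul_comm]
    _ ≤ (∑ j ∈ Finset.range η, |chi c φ₀ a j w| ^ 2) * ∑ j ∈ Finset.range η, ‖γ j‖ ^ 2 :=
        Finset.sum_mul_sq_le_sq_mul_sq _ _ _
    _ = _ := by simp_rw [sq_abs]

variable (η U)

lemma psiIntegrand_nonneg (hs : 0 ≤ s) (ht : 0 < t) (z : Fin NUE × Angles NBS NUE) :
    0 ≤ psiIntegrand c s η U t z := by
  have := gain_nonneg c
  rw [psiIntegrand]
  positivity

lemma psiIntegrand_le_one (hs : 0 ≤ s) (ht : 0 < t) (z : Fin NUE × Angles NBS NUE) :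
    psiIntegrand c s η U t z ≤ 1 := by
  have := gain_nonneg c
  refine inv_le_one_of_one_le₀ (one_le_pow₀ (le_add_of_nonneg_right ?_))
  positivity

lemma measurable_psiIntegrand (s t : ℝ) : Measurable (psiIntegrand c s η U t) := by
  refine measurable_from_prod_countable_right fun i => ?_
  simp only [psiIntegrand]
  fun_prop

lemma integrable_psiIntegrand (hs : 0 ≤ s) (ht : 0 < t) :
    Integrable (psiIntegrand c s η U t) (c.qUE.toMeasure.prod (anglesLaw c)) := by
  refine Integrable.of_bound (C := 1) (measurable_psiIntegrand c η U s t).aestronglyMeasurable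
    (Eventually.of_forall fun z => ?_)
  rw [Real.norm_of_nonneg (psiIntegrand_nonneg c η U hs ht z)]
  exact psiIntegrand_le_one c η U hs ht z

lemma PsiCS_eq (s t : ℝ) : PsiCS c s η U t =
    ∫ z, psiIntegrand c s η U t z ∂(c.qUE.toMeasure.prod (anglesLaw c)) := rfl

lemma PsiCS_nonneg (hs : 0 ≤ s) (ht : 0 < t) : 0 ≤ PsiCS c s η U t :=
  integral_nonneg (psiIntegrand_nonneg c η U hs ht)

lemma PsiCS_le_one (hs : 0 ≤ s) (ht : 0 < t) : PsiCS c s η U t ≤ 1 := by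
  simpa [PsiCS_eq] using integral_mono (integrable_psiIntegrand c η U hs ht) (integrable_const 1)
    (psiIntegrand_le_one c η U hs ht)

lemma ofReal_one_sub_PsiCS (hs : 0 ≤ s) (ht : 0 < t) : ENNReal.ofReal (1 - PsiCS c s η U t) =
    ∫⁻ z, ENNReal.ofReal (1 - psiIntegrand c s η U t z) ∂(c.qUE.toMeasure.prod (anglesLaw c)) := by
  have h_int := integrable_psiIntegrand c η U hs ht
  have h_compl : Integrable (fun z => 1 - psiIntegrand c s η U t z)
    (c.qUE.toMeasure.prod (anglesLaw c)) := (integrable_const 1).sub h_int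
  rw [← ofReal_integral_eq_lintegral_ofReal h_compl
    (Eventually.of_forall fun z => sub_nonneg.2 (psiIntegrand_le_one c η U hs ht z))]
  simp [integral_sub (integrable_const 1) h_int, PsiCS_eq]

end FadingAverage

section MarkAverage

variable {NBS NUE : ℕ} (c : Params NBS NUE) (s : ℝ) (φ₀ : Fin NUE)

/-- The expectation of `1 - e^{-sI}` over fading and angles, for a BS at path loss `t` whose link
has `η` paths and which serves `U` users. -/
def fadingDeficit (η U : ℕ) (t : ℝ) : ℝ≥0∞ :=
  ∫⁻ z, 1 - expNeg (ENNReal.ofReal (scaledPower c φ₀ s η U t z.1 z.2))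
    ∂(fadingLaw.prod (anglesLaw c))

lemma fadingDeficit_eq (η U : ℕ) (t : ℝ) :
    fadingDeficit c s φ₀ η U t =
      ∫⁻ a, 1 - ∫⁻ γ, expNeg (ENNReal.ofReal (scaledPower c φ₀ s η U t γ a)) ∂fadingLaw
        ∂anglesLaw c := by
  have h_meas : Measurable fun z : (ℕ → ℂ) × Angles NBS NUE => scaledPower c φ₀ s η U t z.1 z.2 :=
    (measurable_scaledPower c φ₀ s η U).comp measurable_prodMk_left
  rw [fadingDeficit, lintegral_prod_symm' _ (by fun_prop)]
  exact lintegral_congr fun a => lintegral_one_sub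
    (measurable_expNeg.comp (h_meas.comp measurable_prodMk_right).ennreal_ofReal)
    fun γ => expNeg_le_one _

/-- The expectation of `1 - e^{-sI}` over all marks, for a BS at path loss `t` in link state `b`. -/
def markDeficit (b : Bool) (t : ℝ) : ℝ≥0∞ :=
  ∫⁻ m, 1 - expNeg (ENNReal.ofReal (scaledPower c φ₀ s (c.eta b) m.1 t m.2.1 m.2.2)) ∂markLaw c

lemma measurable_deficit (b : Bool) :
    Measurable fun z : ℝ × ℕ × (ℕ → ℂ) × Angles NBS NUE =>
      1 - expNeg (ENNReal.ofReal (scaledPower c φ₀ s (c.eta b) z.2.1 z.1 z.2.2.1 z.2.2.2)) := by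
  have h_power : Measurable fun z : ℝ × ℕ × (ℕ → ℂ) × Angles NBS NUE =>
      scaledPower c φ₀ s (c.eta b) z.2.1 z.1 z.2.2.1 z.2.2.2 :=
    measurable_comp_countable (g := fun z => z.2.1)
      (f := fun U (z : ℝ × ℕ × (ℕ → ℂ) × Angles NBS NUE) =>
        scaledPower c φ₀ s (c.eta b) U z.1 z.2.2.1 z.2.2.2)
      (fun U => (measurable_scaledPower c φ₀ s (c.eta b) U).comp
        (by fun_prop : Measurable fun z : ℝ × ℕ × (ℕ → ℂ) × Angles NBS NUE => (z.1, z.2.2)))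
      (by fun_prop)
  fun_prop

lemma measurable_markDeficit (b : Bool) : Measurable (markDeficit c s φ₀ b) :=
  (measurable_deficit c s φ₀ b).lintegral_prod_right'

lemma markDeficit_eq (b : Bool) (t : ℝ) :
    markDeficit c s φ₀ b t = ∑' U, c.pU U * fadingDeficit c s φ₀ (c.eta b) U t := by
  have h_meas := (measurable_deficit c s φ₀ b).comp (measurable_prodMk_left (x := t))
  refine (lintegral_prod _ h_meas.aemeasurable).trans ((lintegral_countable' _).trans ?_)
  refine tsum_congr fun U => ?_
  rw [PMF.toMeasure_apply_singleton _ _ (measurableSet_singleton U), mul_comm]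
  rfl

variable {s} {t : ℝ}

lemma le_fadingDeficit (hs : 0 ≤ s) (ht : 0 < t) {η U : ℕ} (hη : η ≠ 0) (hU : U ≠ 0) :
    1 / (1 + (ENNReal.ofReal (s * gain c * t⁻¹ * c.rhoBS ^ 2 * c.rhoUE ^ 2))⁻¹) ≤
      fadingDeficit c s φ₀ η U t := by
  have h_gain := gain_nonneg c
  rw [fadingDeficit_eq, ← one_sub_ofReal_inv_one_add (by positivity)]
  calc _ = ∫⁻ _, 1 - ENNReal.ofReal (1 + s * gain c * t⁻¹ * c.rhoBS ^ 2 * c.rhoUE ^ 2)⁻¹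
        ∂anglesLaw c := by simp
    _ ≤ _ := lintegral_mono fun a => tsub_le_tsub_left (lintegral_fading_le c φ₀ a hs ht hη hU) _

lemma le_markDeficit (hs : 0 ≤ s) (ht : 0 < t) (b : Bool) :
    (1 - c.pU 0) * (1 / (1 + (ENNReal.ofReal (s * gain c * t⁻¹ * c.rhoBS ^ 2 * c.rhoUE ^ 2))⁻¹)) ≤
      markDeficit c s φ₀ b t := by
  rw [markDeficit_eq, ← tsum_pmf_ite_eq_zero, ← ENNReal.tsum_mul_right]
  refine ENNReal.tsum_le_tsum fun U => ?_
  split_ifs with hU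
  · simp
  · gcongr
    exact le_fadingDeficit c φ₀ hs ht (Nat.one_le_iff_ne_zero.1 (c.eta_pos b)) hU

lemma sum_fadingDeficit_le (hs : 0 ≤ s) (ht : 0 < t) (η U : ℕ) :
    ∑ i, c.qUE i * fadingDeficit c s i η U t ≤ ENNReal.ofReal (1 - PsiCS c s η U t) := by
  have h_meas := measurable_psiIntegrand c η U s t
  rw [ofReal_one_sub_PsiCS c η U hs ht, lintegral_prod _ (by fun_prop), lintegral_fintype]
  refine Finset.sum_le_sum fun i _ => ?_
  rw [PMF.toMeasure_apply_singleton _ _ (measurableSet_singleton i), mul_comm, fadingDeficit_eq]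
  gcongr with a
  rw [ENNReal.ofReal_sub _ (psiIntegrand_nonneg c η U hs ht _), ENNReal.ofReal_one]
  exact tsub_le_tsub_left (ofReal_psiIntegrand_le c i a hs ht) _

lemma sum_markDeficit_le (hs : 0 ≤ s) (ht : 0 < t) (b : Bool) :
    ∑ i, c.qUE i * markDeficit c s i b t ≤
      ENNReal.ofReal (1 - ∑' U, (c.pU U).toReal * PsiCS c s (c.eta b) U t) := by
  simp_rw [markDeficit_eq, ← ENNReal.tsum_mul_left]
  rw [← tsum_pmf_mul_ofReal_one_sub c.pU (fun U => PsiCS_nonneg c (c.eta b) U hs ht)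
    (fun U => PsiCS_le_one c (c.eta b) U hs ht),
    ← Summable.tsum_finsetSum fun i _ => ENNReal.summable]
  refine ENNReal.tsum_le_tsum fun U => ?_
  simp_rw [mul_left_comm _ (c.pU U)]
  rw [← Finset.mul_sum]
  gcongr
  exact sum_fadingDeficit_le c hs ht (c.eta b) U

end MarkAverage

section LaplaceBounds

variable {NBS NUE : ℕ} (c : Params NBS NUE)

lemma setLIntegral_lossIntensity (b : Bool) (l : ℝ) {f : Bool → ℝ → ℝ≥0∞}
    (hf : ∀ b, Measurable (f b)) :
    ∫⁻ t in Set.Ioi l, f b t ∂lossIntensity c b =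
      ∫⁻ x, (Set.Ioi l).indicator (f x.2.1) (pathLoss c x) ∂linkIntensity c b := by
  rw [lintegral_linkIntensity_congr c b
    (f := fun b x => (Set.Ioi l).indicator (f b) (pathLoss c x))
    (fun b => ((hf b).indicator measurableSet_Ioi).comp (measurable_pathLoss c)),
    ← lintegral_indicator measurableSet_Ioi, lossIntensity,
    lintegral_map ((hf b).indicator measurableSet_Ioi) (measurable_pathLoss c)]

lemma laplaceBeyond_eq (s : ℝ) (φ₀ : Fin NUE) (l : ℝ) :
    laplaceBeyond c s φ₀ l =
      expNeg (∫⁻ t in Set.Ioi l, markDeficit c s φ₀ true t ∂lossIntensity c true +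
        ∫⁻ t in Set.Ioi l, markDeficit c s φ₀ false t ∂lossIntensity c false) := by
  have h_beyond : MeasurableSet {y : Station NBS NUE | l < pathLoss c y.1} :=
    measurableSet_lt measurable_const (by fun_prop)
  have h_marks (x : Link) : ∫⁻ m, {y : Station NBS NUE | l < pathLoss c y.1}.indicator
      (fun y => 1 - expNeg (ENNReal.ofReal (s * power c φ₀ y))) (x, m) ∂markLaw c =
      (Set.Ioi l).indicator (markDeficit c s φ₀ x.2.1) (pathLoss c x) := by
    by_cases hx : l < pathLoss c x
    · simp only [Set.indicator, Set.mem_ofPred_eq, hx, if_true, Set.mem_Ioi, markDeficit,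
        mul_power]
    · simp [Set.indicator, hx]
  rw [laplaceBeyond, ← lintegral_indicator h_beyond,
    lintegral_stationIntensity c (Measurable.indicator (by fun_prop) h_beyond)]
  simp_rw [h_marks, setLIntegral_lossIntensity c _ l (measurable_markDeficit c s φ₀)]

lemma ae_lossIntensity_pos (b : Bool) : ∀ᵐ t ∂lossIntensity c b, 0 < t := by
  rw [lossIntensity, ae_map_iff (measurable_pathLoss c).aemeasurable measurableSet_Ioi]
  exact Eventually.of_forall (pathLoss_pos c)

lemma setLIntegral_Ioi_eq_Ici (b : Bool) (l : ℝ) (f : ℝ → ℝ≥0∞) :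
    ∫⁻ t in Set.Ioi l, f t ∂lossIntensity c b = ∫⁻ t in Set.Ici l, f t ∂lossIntensity c b := by
  refine setLIntegral_congr (Ioi_ae_eq_Ici' ?_)
  rw [lossIntensity, Measure.map_apply (measurable_pathLoss c) (measurableSet_singleton l)]
  exact linkIntensity_pathLoss_eq c b l

lemma setLIntegral_lossIntensity_mono (b : Bool) (l : ℝ) {f g : ℝ → ℝ≥0∞}
    (h : ∀ t, 0 < t → f t ≤ g t) :
    ∫⁻ t in Set.Ici l, f t ∂lossIntensity c b ≤ ∫⁻ t in Set.Ici l, g t ∂lossIntensity c b :=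
  lintegral_mono_ae (ae_restrict_of_ae ((ae_lossIntensity_pos c b).mono h))

variable {s : ℝ}

lemma laplaceBeyond_le (hs : 0 ≤ s) (φ₀ : Fin NUE) (l : ℝ) :
    laplaceBeyond c s φ₀ l ≤ expNeg ((1 - c.pU 0) * upperExponent c s l) := by
  rw [laplaceBeyond_eq, upperExponent, Measure.restrict_add, lintegral_add_measure, mul_add]
  simp_rw [setLIntegral_Ioi_eq_Ici]
  rw [← lintegral_const_mul _ (by fun_prop), ← lintegral_const_mul _ (by fun_prop)]
  exact expNeg_antitone (add_le_add
    (setLIntegral_lossIntensity_mono c true l fun t ht => le_markDeficit c φ₀ hs ht true)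
    (setLIntegral_lossIntensity_mono c false l fun t ht => le_markDeficit c φ₀ hs ht false))

lemma sum_setLIntegral_markDeficit_le (hs : 0 ≤ s) (b : Bool) (l : ℝ) :
    ∑ i, c.qUE i * ∫⁻ t in Set.Ioi l, markDeficit c s i b t ∂lossIntensity c b ≤
      lowerExponent c (PsiCS c s) b l := by
  simp_rw [← lintegral_const_mul _ (measurable_markDeficit c s _ b)]
  rw [← lintegral_finsetSum _ fun i _ => (measurable_markDeficit c s i b).const_mul _,
    setLIntegral_Ioi_eq_Ici]
  exact setLIntegral_lossIntensity_mono c b l fun t ht => sum_markDeficit_le c hs ht b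

lemma sum_qUE : ∑ i, c.qUE i = 1 := by rw [← c.qUE.tsum_coe, tsum_fintype]

/-- Jensen's inequality replaces the average over the AOA of the service link by an average in the
exponent. -/
lemma le_sum_laplaceBeyond (hs : 0 ≤ s) (l : ℝ) :
    expNeg (lowerExponent c (PsiCS c s) true l) * expNeg (lowerExponent c (PsiCS c s) false l) ≤
      ∑ i, c.qUE i * laplaceBeyond c s i l := by
  simp_rw [laplaceBeyond_eq]
  refine le_trans ?_ (expNeg_sum_mul_le _ (sum_qUE c) _)
  simp_rw [← expNeg_add, mul_add, Finset.sum_add_distrib]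
  exact expNeg_antitone (add_le_add (sum_setLIntegral_markDeficit_le c hs true l)
    (sum_setLIntegral_markDeficit_le c hs false l))

lemma sum_laplaceBeyond_le (hs : 0 ≤ s) (l : ℝ) :
    ∑ i, c.qUE i * laplaceBeyond c s i l ≤ expNeg ((1 - c.pU 0) * upperExponent c s l) :=
  calc ∑ i, c.qUE i * laplaceBeyond c s i l
      ≤ ∑ i, c.qUE i * expNeg ((1 - c.pU 0) * upperExponent c s l) := by
        gcongr with i
        exact laplaceBeyond_le c hs i l
    _ = expNeg ((1 - c.pU 0) * upperExponent c s l) := by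
        rw [← Finset.sum_mul, sum_qUE, one_mul]

lemma lowerExponent_antitone {Ψ₁ Ψ₂ : ℕ → ℕ → ℝ → ℝ} (b : Bool) (l : ℝ)
    (h_nonneg : ∀ U t, 0 < t → 0 ≤ Ψ₁ (c.eta b) U t)
    (h_le : ∀ U t, 0 < t → Ψ₁ (c.eta b) U t ≤ Ψ₂ (c.eta b) U t)
    (h_one : ∀ U t, 0 < t → Ψ₂ (c.eta b) U t ≤ 1) :
    lowerExponent c Ψ₂ b l ≤ lowerExponent c Ψ₁ b l := by
  refine setLIntegral_lossIntensity_mono c b l fun t ht => ?_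
  gcongr ENNReal.ofReal (1 - ?_)
  exact Summable.tsum_le_tsum
    (fun U => mul_le_mul_of_nonneg_left (h_le U t ht) ENNReal.toReal_nonneg)
    (summable_pmf_mul c.pU (fun U => h_nonneg U t ht)
      fun U => (h_le U t ht).trans (h_one U t ht))
    (summable_pmf_mul c.pU (fun U => (h_nonneg U t ht).trans (h_le U t ht))
      fun U => h_one U t ht)

end LaplaceBounds

section Mixtures

variable (η : ℕ) {C : ℝ}

lemma integrable_exp_neg_sum_norm {v : ℝ} (hv : 0 ≤ v) :
    Integrable (fun γ : ℕ → ℂ => Real.exp (-(v * ∑ j ∈ Finset.range η, ‖γ j‖ ^ 2))) fadingLaw := by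
  refine Integrable.of_bound (C := 1) (Measurable.aestronglyMeasurable (by fun_prop))
    (Eventually.of_forall fun γ => ?_)
  rw [Real.norm_of_nonneg (Real.exp_pos _).le, Real.exp_le_one_iff, neg_nonpos]
  positivity

lemma integral_exp_neg_sum_norm {v : ℝ} (hv : 0 ≤ v) :
    ∫ γ, Real.exp (-(v * ∑ j ∈ Finset.range η, ‖γ j‖ ^ 2)) ∂fadingLaw = ((1 + v) ^ η)⁻¹ := by
  rw [integral_eq_lintegral_of_nonneg_ae (Eventually.of_forall fun γ => (Real.exp_pos _).le)
    (integrable_exp_neg_sum_norm η hv).aestronglyMeasurable,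
    ← ENNReal.toReal_ofReal (r := ((1 + v) ^ η)⁻¹) (by positivity),
    ← lintegral_expNeg_sum_norm η hv]
  congr 1
  exact lintegral_congr fun γ => (expNeg_ofReal (by positivity)).symm

section

variable {ι : Type*} [Fintype ι] (w : ι → ℝ) {x : ι → ℝ}

lemma integrable_sum_mul_exp (hx : ∀ i, 0 ≤ x i) (hC : 0 ≤ C) :
    Integrable (fun γ : ℕ → ℂ => ∑ i, w i *
      Real.exp (-(C * x i * ∑ j ∈ Finset.range η, ‖γ j‖ ^ 2))) fadingLaw :=
  integrable_finsetSum _ fun i _ =>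
    (integrable_exp_neg_sum_norm η (mul_nonneg hC (hx i))).const_mul _

lemma integral_sum_mul_exp (hx : ∀ i, 0 ≤ x i) (hC : 0 ≤ C) :
    ∫ γ, ∑ i, w i * Real.exp (-(C * x i * ∑ j ∈ Finset.range η, ‖γ j‖ ^ 2)) ∂fadingLaw =
      ∑ i, w i * ((1 + C * x i) ^ η)⁻¹ := by
  rw [integral_finsetSum _ fun i _ =>
    (integrable_exp_neg_sum_norm η (mul_nonneg hC (hx i))).const_mul _]
  refine Finset.sum_congr rfl fun i _ => ?_
  rw [integral_const_mul, integral_exp_neg_sum_norm η (mul_nonneg hC (hx i))]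

end

/-- `(1 + C x)^{-η}` is the expectation of `exp (-C x ∑ |γ_j|²)`, so that an inequality between
Laplace transforms carries over to it. -/
lemma sum_mul_inv_pow_le {ι κ : Type*} [Fintype ι] [Fintype κ] {w x : ι → ℝ} {v y : κ → ℝ}
    (hx : ∀ i, 0 ≤ x i) (hy : ∀ k, 0 ≤ y k)
    (h : ∀ a : ℝ, 0 ≤ a → ∑ i, w i * Real.exp (-(a * x i)) ≤ ∑ k, v k * Real.exp (-(a * y k)))
    (hC : 0 ≤ C) :
    ∑ i, w i * ((1 + C * x i) ^ η)⁻¹ ≤ ∑ k, v k * ((1 + C * y k) ^ η)⁻¹ := by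
  rw [← integral_sum_mul_exp η w hx hC, ← integral_sum_mul_exp η v hy hC]
  refine integral_mono (integrable_sum_mul_exp η w hx hC) (integrable_sum_mul_exp η v hy hC)
    fun γ => ?_
  simpa only [mul_right_comm] using h (C * ∑ j ∈ Finset.range η, ‖γ j‖ ^ 2) (by positivity)

end Mixtures

section BinomialWeight

/-- The probability of `m` successes in `η` independent trials of success probability `q`. -/
def binomialWeight (η : ℕ) (q : ℝ) (m : ℕ) : ℝ := η.choose m * q ^ m * (1 - q) ^ (η - m)

lemma binomialWeight_nonneg (η m : ℕ) {q : ℝ} (hq : 0 ≤ q) (hq_one : q ≤ 1) :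
    0 ≤ binomialWeight η q m := by
  have := sub_nonneg.2 hq_one
  rw [binomialWeight]
  positivity

lemma mul_binomialWeight (η m : ℕ) (q : ℝ) :
    q * binomialWeight η q m = η.choose m * q ^ (m + 1) * (1 - q) ^ (η - m) := by
  rw [binomialWeight]
  ring

lemma sum_finset_binomialWeight (η : ℕ) (q : ℝ) (f : ℕ → ℝ) :
    ∑ T : Finset (Fin η), q ^ T.card * (1 - q) ^ (η - T.card) * f T.card =
      ∑ m ∈ Finset.range (η + 1), binomialWeight η q m * f m := by
  rw [← Finset.powerset_univ,
    Finset.sum_powerset_apply_card (fun m => q ^ m * (1 - q) ^ (η - m) * f m), Finset.card_univ,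
    Fintype.card_fin]
  refine Finset.sum_congr rfl fun m _ => ?_
  rw [nsmul_eq_mul, binomialWeight]
  ring

variable {ι : Type*} [Fintype ι] [DecidableEq ι] {η : ℕ} {q : ι → ℝ}

lemma sum_erase_eq_one_sub (hq : ∑ i, q i = 1) (i : ι) :
    ∑ x ∈ Finset.univ.erase i, q x = 1 - q i := by
  rw [← hq, ← Finset.add_sum_erase Finset.univ q (Finset.mem_univ i), add_sub_cancel_left]

lemma sum_prod_filter_eq (hq : ∑ i, q i = 1) (i : ι) (T : Finset (Fin η)) :
    ∑ φ : Fin η → ι with ({r | φ r = i} : Finset (Fin η)) = T, ∏ r, q (φ r) =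
      q i ^ T.card * (1 - q i) ^ (η - T.card) := by
  have h_fiber : ({φ : Fin η → ι | ({r | φ r = i} : Finset (Fin η)) = T} : Finset (Fin η → ι)) =
      Fintype.piFinset fun r => if r ∈ T then {i} else Finset.univ.erase i := by
    ext φ
    simp only [Finset.mem_filter, Finset.mem_univ, true_and, Fintype.mem_piFinset, Finset.ext_iff]
    refine forall_congr' fun r => ?_
    by_cases hr : r ∈ T <;> simp [hr]
  have h_coordinate (r : Fin η) : ∑ x ∈ (if r ∈ T then {i} else Finset.univ.erase i), q x =
      if r ∈ T then q i else 1 - q i := by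
    split_ifs
    exacts [Finset.sum_singleton _ _, sum_erase_eq_one_sub hq i]
  rw [h_fiber, ← Finset.prod_univ_sum]
  simp_rw [h_coordinate]
  rw [Finset.prod_ite]
  simp [Finset.filter_not, Finset.card_sdiff]

lemma sum_prod_mul_card (hq : ∑ i, q i = 1) (i : ι) (f : ℕ → ℝ) :
    ∑ φ : Fin η → ι, (∏ r, q (φ r)) * f ({r | φ r = i} : Finset (Fin η)).card =
      ∑ m ∈ Finset.range (η + 1), binomialWeight η (q i) m * f m := by
  rw [← sum_finset_binomialWeight, ← Finset.sum_fiberwise Finset.univ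
    (fun φ : Fin η → ι => ({r | φ r = i} : Finset (Fin η)))]
  refine Finset.sum_congr rfl fun T _ => ?_
  rw [← sum_prod_filter_eq hq i T, Finset.sum_mul]
  refine Finset.sum_congr rfl fun φ hφ => ?_
  rw [(Finset.mem_filter.1 hφ).2]

end BinomialWeight

section AlignedGain

/-- The value of `∑_j a_j² b_j²` for `η` paths when `m` AOAs and `j` AODs are aligned, in the
arrangement that maximises it: the aligned AOAs and AODs sit on the first paths. -/
def alignedGain (ρB ρU : ℝ) (η j m : ℕ) : ℝ :=
  ∑ r ∈ Finset.Icc 1 η, (ρB ^ 2 + if r ≤ j then 1 - ρB ^ 2 else 0) *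
    (ρU ^ 2 + if r ≤ m then 1 - ρU ^ 2 else 0)

variable {N η : ℕ} {ρB ρU : ℝ}

lemma alignedGain_nonneg (ρB ρU : ℝ) (η j m : ℕ) : 0 ≤ alignedGain ρB ρU η j m := by
  refine Finset.sum_nonneg fun r _ => mul_nonneg ?_ ?_ <;> split_ifs <;> nlinarith

lemma sum_Icc_ite_le {j : ℕ} (hj : j ≤ η) (x : ℝ) :
    ∑ r ∈ Finset.Icc 1 η, (if r ≤ j then x else 0) = j * x := by
  have h_filter : (Finset.Icc 1 η).filter (· ≤ j) = Finset.Icc 1 j := by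
    ext r
    simp only [Finset.mem_filter, Finset.mem_Icc]
    omega
  rw [← Finset.sum_filter, h_filter, Finset.sum_const, Nat.card_Icc, nsmul_eq_mul,
    Nat.add_sub_cancel]

lemma alignedGain_eq (ρB ρU : ℝ) {j m : ℕ} (hj : j ≤ η) (hm : m ≤ η) :
    alignedGain ρB ρU η j m = ρB ^ 2 * (η * ρU ^ 2 + m * (1 - ρU ^ 2)) +
      (1 - ρB ^ 2) * (j * ρU ^ 2 + (min j m : ℕ) * (1 - ρU ^ 2)) := by
  have h_term (r : ℕ) : (ρB ^ 2 + if r ≤ j then 1 - ρB ^ 2 else 0) *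
      (ρU ^ 2 + if r ≤ m then 1 - ρU ^ 2 else 0) =
      ρB ^ 2 * ρU ^ 2 + (if r ≤ m then ρB ^ 2 * (1 - ρU ^ 2) else 0) +
        (if r ≤ j then (1 - ρB ^ 2) * ρU ^ 2 else 0) +
        (if r ≤ min j m then (1 - ρB ^ 2) * (1 - ρU ^ 2) else 0) := by
    simp only [le_min_iff]
    by_cases h1 : r ≤ j <;> by_cases h2 : r ≤ m <;> simp [h1, h2] <;> ring
  rw [alignedGain, Finset.sum_congr rfl fun r _ => h_term r, Finset.sum_add_distrib,
    Finset.sum_add_distrib, Finset.sum_add_distrib, sum_Icc_ite_le hm, sum_Icc_ite_le hj,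
    sum_Icc_ite_le ((min_le_left j m).trans hj), Finset.sum_const, Nat.card_Icc, nsmul_eq_mul,
    Nat.add_sub_cancel]
  ring

lemma beamInner_sq (ρ : ℝ) (i k : Fin N) :
    beamInner ρ i k ^ 2 = ρ ^ 2 + if k = i then 1 - ρ ^ 2 else 0 := by
  rw [beamInner]
  by_cases h : i = k
  · simp [h]
  · simp [h, Ne.symm h]

lemma sum_beamInner_sq (ρ : ℝ) (i : Fin N) (φ : Fin η → Fin N) (S : Finset (Fin η)) :
    ∑ r ∈ S, beamInner ρ i (φ r) ^ 2 =
      S.card * ρ ^ 2 + (S ∩ ({r | φ r = i} : Finset (Fin η))).card * (1 - ρ ^ 2) := by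
  simp_rw [beamInner_sq]
  rw [Finset.sum_add_distrib, Finset.sum_const, nsmul_eq_mul, ← Finset.sum_filter,
    Finset.sum_const, nsmul_eq_mul, Finset.inter_filter, Finset.inter_univ]

lemma sum_beamInner_sq_le_alignedGain (hB : ρB ^ 2 ≤ 1) (hU : ρU ^ 2 ≤ 1) (i : Fin N)
    (φ : Fin η → Fin N) (T : Finset (Fin η)) :
    ∑ r ∈ T, beamInner ρU i (φ r) ^ 2 + ∑ r ∈ Tᶜ, beamInner ρU i (φ r) ^ 2 * ρB ^ 2 ≤
      alignedGain ρB ρU η T.card ({r | φ r = i} : Finset (Fin η)).card := by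
  have h_card (S : Finset (Fin η)) : S.card ≤ η := by simpa using Finset.card_le_univ S
  set J : Finset (Fin η) := {r | φ r = i}
  have h_total : ∑ r, beamInner ρU i (φ r) ^ 2 = η * ρU ^ 2 + J.card * (1 - ρU ^ 2) := by
    rw [sum_beamInner_sq, Finset.univ_inter, Finset.card_univ, Fintype.card_fin]
  have h_split := Finset.sum_add_sum_compl T fun r => beamInner ρU i (φ r) ^ 2
  have h_overlap : ((T ∩ J).card : ℝ) ≤ (min T.card J.card : ℕ) := by
    exact_mod_cast le_min (Finset.card_le_card Finset.inter_subset_left)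
      (Finset.card_le_card Finset.inter_subset_right)
  rw [alignedGain_eq _ _ (h_card T) (h_card J), ← Finset.sum_mul,
    eq_sub_of_add_eq' (h_split.trans h_total), sum_beamInner_sq]
  have h_excess := mul_le_mul_of_nonneg_left
    (mul_le_mul_of_nonneg_right h_overlap (sub_nonneg.2 hU)) (sub_nonneg.2 hB)
  linarith

end AlignedGain

section LaplaceComparison

lemma sum_prod_mul_exp {ι κ : Type*} [Fintype ι] [Fintype κ] [DecidableEq κ] (q : ι → ℝ)
    (x : κ → ι → ℝ) (a : ℝ) :
    ∑ θ : κ → ι, (∏ r, q (θ r)) * Real.exp (-(a * ∑ r, x r (θ r))) =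
      ∏ r, ∑ i, q i * Real.exp (-(a * x r i)) := by
  rw [Fintype.prod_sum]
  refine Finset.sum_congr rfl fun θ _ => ?_
  rw [Finset.prod_mul_distrib, ← Real.exp_sum, Finset.sum_neg_distrib, ← Finset.mul_sum]

lemma sum_mul_beamInner {n : ℕ} {q : Fin n → ℝ} (hq : ∑ i, q i = 1) (ρ : ℝ) (k : Fin n)
    (f : ℝ → ℝ) :
    ∑ x, q x * f (beamInner ρ x k) = q k * f 1 + (1 - q k) * f ρ := by
  rw [← Finset.add_sum_erase Finset.univ _ (Finset.mem_univ k), ← sum_erase_eq_one_sub hq k,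
    Finset.sum_mul]
  congr 1
  · rw [beamInner, if_pos rfl]
  · exact Finset.sum_congr rfl fun x hx => by rw [beamInner, if_neg (Finset.ne_of_mem_erase hx)]

variable {M N η : ℕ} {qB : Fin M → ℝ} {qU : Fin N → ℝ} {ρB ρU a : ℝ}

lemma sum_binomialWeight_exp_le_prod (hB : ρB ^ 2 ≤ 1) (hU : ρU ^ 2 ≤ 1) (i : Fin N)
    (φ : Fin η → Fin N) {q : ℝ} (hq : 0 ≤ q) (hq_one : q ≤ 1) (ha : 0 ≤ a) :
    ∑ j ∈ Finset.range (η + 1), binomialWeight η q j *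
        Real.exp (-(a * alignedGain ρB ρU η j ({r | φ r = i} : Finset (Fin η)).card)) ≤
      ∏ r, (q * Real.exp (-(a * beamInner ρU i (φ r) ^ 2)) +
        (1 - q) * Real.exp (-(a * (beamInner ρU i (φ r) ^ 2 * ρB ^ 2)))) := by
  rw [Fintype.prod_add, ← sum_finset_binomialWeight η q fun j =>
    Real.exp (-(a * alignedGain ρB ρU η j ({r | φ r = i} : Finset (Fin η)).card))]
  refine Finset.sum_le_sum fun T _ => ?_
  rw [Finset.prod_mul_distrib, Finset.prod_mul_distrib, Finset.prod_const, Finset.prod_const,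
    ← Real.exp_sum, ← Real.exp_sum, mul_mul_mul_comm, ← Real.exp_add, Finset.card_compl,
    Fintype.card_fin, Finset.sum_neg_distrib, Finset.sum_neg_distrib, ← Finset.mul_sum,
    ← Finset.mul_sum, ← neg_add, ← mul_add]
  have := sub_nonneg.2 hq_one
  gcongr
  exact sum_beamInner_sq_le_alignedGain hB hU i φ T

lemma sum_departure_exp_eq (hqB : ∑ k, qB k = 1) (x : Fin η → ℝ) (k : Fin M) :
    ∑ θ : Fin η → Fin M, (∏ r, qB (θ r)) *
        Real.exp (-(a * ∑ r, x r * beamInner ρB (θ r) k ^ 2)) =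
      ∏ r, (qB k * Real.exp (-(a * x r)) +
        (1 - qB k) * Real.exp (-(a * (x r * ρB ^ 2)))) := by
  rw [sum_prod_mul_exp qB (fun r θ => x r * beamInner ρB θ k ^ 2)]
  refine Finset.prod_congr rfl fun r _ => ?_
  rw [sum_mul_beamInner hqB ρB k (fun y => Real.exp (-(a * (x r * y ^ 2))))]
  simp only [one_pow, mul_one]

/-- Jensen's inequality for `x ↦ x ^ U`: the beams of a BS are positively correlated through the
AODs of the paths, which they share. -/
lemma pow_sum_departure_exp_le (hqB : ∑ k, qB k = 1) (hqB_nonneg : ∀ k, 0 ≤ qB k)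
    (x : Fin η → ℝ) (U : ℕ) :
    (∑ k, qB k * ∑ θ : Fin η → Fin M, (∏ r, qB (θ r)) *
        Real.exp (-(a * ∑ r, x r * beamInner ρB (θ r) k ^ 2))) ^ U ≤
      ∑ θ : Fin η → Fin M, (∏ r, qB (θ r)) * ∑ k : Fin U → Fin M, (∏ n, qB (k n)) *
        Real.exp (-(a * ∑ n, ∑ r, x r * beamInner ρB (θ r) (k n) ^ 2)) := by
  set beam : (Fin η → Fin M) → ℝ := fun θ =>
    ∑ k, qB k * Real.exp (-(a * ∑ r, x r * beamInner ρB (θ r) k ^ 2)) with h_beam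
  have h_pow (θ : Fin η → Fin M) : ∑ k : Fin U → Fin M, (∏ n, qB (k n)) *
      Real.exp (-(a * ∑ n, ∑ r, x r * beamInner ρB (θ r) (k n) ^ 2)) = beam θ ^ U := by
    rw [sum_prod_mul_exp qB (fun _ k => ∑ r, x r * beamInner ρB (θ r) k ^ 2)]
    simp only [h_beam, Finset.prod_const, Finset.card_univ, Fintype.card_fin]
  have h_swap : ∑ k, qB k * ∑ θ : Fin η → Fin M, (∏ r, qB (θ r)) *
      Real.exp (-(a * ∑ r, x r * beamInner ρB (θ r) k ^ 2)) =
      ∑ θ : Fin η → Fin M, (∏ r, qB (θ r)) * beam θ := by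
    simp_rw [h_beam, Finset.mul_sum, mul_left_comm (qB _)]
    exact Finset.sum_comm
  rw [h_swap, Finset.sum_congr rfl fun θ _ => congrArg _ (h_pow θ)]
  exact Real.pow_arith_mean_le_arith_mean_pow Finset.univ _ beam
    (fun θ _ => Finset.prod_nonneg fun r _ => hqB_nonneg _)
    (by rw [← Fintype.sum_pow, hqB, one_pow])
    (fun θ _ => Finset.sum_nonneg fun k _ => mul_nonneg (hqB_nonneg k) (Real.exp_pos _).le) U

lemma pow_sum_binomialWeight_exp_le (hqB : ∑ k, qB k = 1) (hqB_nonneg : ∀ k, 0 ≤ qB k)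
    (hB : ρB ^ 2 ≤ 1) (hU : ρU ^ 2 ≤ 1) (i : Fin N) (φ : Fin η → Fin N) (U : ℕ) (ha : 0 ≤ a) :
    (∑ k, qB k * ∑ j ∈ Finset.range (η + 1), binomialWeight η (qB k) j *
        Real.exp (-(a * alignedGain ρB ρU η j ({r | φ r = i} : Finset (Fin η)).card))) ^ U ≤
      ∑ θ : Fin η → Fin M, (∏ r, qB (θ r)) * ∑ k : Fin U → Fin M, (∏ n, qB (k n)) *
        Real.exp (-(a * ∑ n, ∑ r, beamInner ρU i (φ r) ^ 2 * beamInner ρB (θ r) (k n) ^ 2)) := by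
  have hqB_one (k : Fin M) : qB k ≤ 1 :=
    hqB ▸ Finset.single_le_sum (fun k _ => hqB_nonneg k) (Finset.mem_univ k)
  refine le_trans (pow_le_pow_left₀ (Finset.sum_nonneg fun k _ => mul_nonneg (hqB_nonneg k)
    (Finset.sum_nonneg fun j _ => ?_)) (Finset.sum_le_sum fun k _ => ?_) U)
    (pow_sum_departure_exp_le hqB hqB_nonneg (fun r => beamInner ρU i (φ r) ^ 2) U)
  · exact mul_nonneg (binomialWeight_nonneg η j (hqB_nonneg k) (hqB_one k)) (Real.exp_pos _).le
  · rw [sum_departure_exp_eq hqB]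
    exact mul_le_mul_of_nonneg_left
      (sum_binomialWeight_exp_le_prod hB hU i φ (hqB_nonneg k) (hqB_one k) ha) (hqB_nonneg k)

lemma sum_prod_binomialWeight_exp (U : ℕ) (x : ℕ → ℝ) :
    ∑ k : Fin U → Fin M, ∑ j : Fin U → Fin (η + 1),
      (∏ n, qB (k n) * binomialWeight η (qB (k n)) (j n)) * Real.exp (-(a * ∑ n, x (j n))) =
    (∑ k, qB k * ∑ j ∈ Finset.range (η + 1), binomialWeight η (qB k) j *
      Real.exp (-(a * x j))) ^ U := by
  rw [Fintype.sum_pow]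
  refine Finset.sum_congr rfl fun k _ => ?_
  simp_rw [Finset.sum_range, Finset.mul_sum]
  rw [Fintype.prod_sum]
  refine Finset.sum_congr rfl fun j _ => ?_
  simp_rw [← mul_assoc]
  rw [← Finset.sum_neg_distrib, Real.exp_sum, ← Finset.prod_mul_distrib]

lemma sum_aligned_exp_le (hqB : ∑ k, qB k = 1) (hqB_nonneg : ∀ k, 0 ≤ qB k)
    (hqU : ∑ i, qU i = 1) (hqU_nonneg : ∀ i, 0 ≤ qU i) (hB : ρB ^ 2 ≤ 1) (hU : ρU ^ 2 ≤ 1)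
    (i : Fin N) (U : ℕ) (ha : 0 ≤ a) :
    ∑ m ∈ Finset.range (η + 1), binomialWeight η (qU i) m *
      ∑ k : Fin U → Fin M, ∑ j : Fin U → Fin (η + 1),
        (∏ n, qB (k n) * binomialWeight η (qB (k n)) (j n)) *
          Real.exp (-(a * ∑ n, alignedGain ρB ρU η (j n) m)) ≤
    ∑ φ : Fin η → Fin N, (∏ r, qU (φ r)) * ∑ θ : Fin η → Fin M, (∏ r, qB (θ r)) *
      ∑ k : Fin U → Fin M, (∏ n, qB (k n)) *
        Real.exp (-(a * ∑ n, ∑ r, beamInner ρU i (φ r) ^ 2 * beamInner ρB (θ r) (k n) ^ 2)) := by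
  simp_rw [fun m => sum_prod_binomialWeight_exp (qB := qB) (a := a) (η := η) U
    fun j => alignedGain ρB ρU η j m]
  rw [← sum_prod_mul_card hqU i]
  exact Finset.sum_le_sum fun φ _ => mul_le_mul_of_nonneg_left
    (pow_sum_binomialWeight_exp_le hqB hqB_nonneg hB hU i φ U ha)
    (Finset.prod_nonneg fun r _ => hqU_nonneg (φ r))

end LaplaceComparison

section FiniteAngles

variable {NBS NUE : ℕ} (c : Params NBS NUE)

lemma map_restrict_infinitePi {N : ℕ} (q : PMF (Fin N)) (n : ℕ) :
    (Measure.infinitePi fun _ : ℕ => q.toMeasure).map (fun φ (r : Fin n) => φ r) =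
      Measure.pi fun _ : Fin n => q.toMeasure := by
  have h_indep : iIndepFun (fun (r : Fin n) (φ : ℕ → Fin N) => φ r)
      (Measure.infinitePi fun _ : ℕ => q.toMeasure) :=
    (iIndepFun_infinitePi (P := fun _ : ℕ => q.toMeasure) (X := fun _ x => x)
      (fun _ => measurable_id)).precomp Fin.val_injective
  rw [(iIndepFun_iff_map_fun_eq_pi_map
    (fun r : Fin n => (measurable_pi_apply (r : ℕ)).aemeasurable)).1 h_indep]
  congr 1
  ext1 r
  exact (measurePreserving_eval_infinitePi (fun _ : ℕ => q.toMeasure) (r : ℕ)).map_eq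

/-- The AOA of the service link, and the virtual angles that matter for a BS with `η` paths and `U`
users. -/
abbrev FiniteAngles (NBS NUE η U : ℕ) : Type :=
  Fin NUE × (Fin η → Fin NUE) × (Fin η → Fin NBS) × (Fin U → Fin NBS)

variable (η U : ℕ)

/-- Restriction of the virtual angles to the first `η` paths and the first `U` beams. -/
def restrictAngles : Fin NUE × Angles NBS NUE → FiniteAngles NBS NUE η U :=
  Prod.map id (Prod.map (fun φ r => φ r) (Prod.map (fun θ r => θ r) (fun k n => k n)))

/-- The joint law of the finitely many angles of `FiniteAngles`. -/
def finiteAnglesLaw : Measure (FiniteAngles NBS NUE η U) :=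
  c.qUE.toMeasure.prod ((Measure.pi fun _ : Fin η => c.qUE.toMeasure).prod
    ((Measure.pi fun _ : Fin η => c.qBS.toMeasure).prod
      (Measure.pi fun _ : Fin U => c.qBS.toMeasure)))

/-- The probability of a configuration of angles. -/
def angleWeight (x : FiniteAngles NBS NUE η U) : ℝ :=
  (c.qUE x.1).toReal * ((∏ r, (c.qUE (x.2.1 r)).toReal) *
    ((∏ r, (c.qBS (x.2.2.1 r)).toReal) * ∏ n, (c.qBS (x.2.2.2 n)).toReal))

/-- The sum `∑_w ∑_j χ_{j,w}²`. -/
def angleGain (x : FiniteAngles NBS NUE η U) : ℝ :=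
  ∑ n, ∑ r, beamInner c.rhoUE x.1 (x.2.1 r) ^ 2 * beamInner c.rhoBS (x.2.2.1 r) (x.2.2.2 n) ^ 2

lemma measurable_restrictAngles :
    Measurable (restrictAngles η U : Fin NUE × Angles NBS NUE → FiniteAngles NBS NUE η U) := by
  unfold restrictAngles Prod.map
  fun_prop

lemma map_restrictAngles :
    (c.qUE.toMeasure.prod (anglesLaw c)).map (restrictAngles η U) = finiteAnglesLaw c η U := by
  have h_arrivals : Measurable fun (φ : ℕ → Fin NUE) (r : Fin η) => φ r := by fun_prop
  have h_departures : Measurable fun (θ : ℕ → Fin NBS) (r : Fin η) => θ r := by fun_prop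
  have h_beams : Measurable fun (k : ℕ → Fin NBS) (n : Fin U) => k n := by fun_prop
  rw [restrictAngles, anglesLaw, ← Measure.map_prod_map _ _ measurable_id
      (h_arrivals.prodMap (h_departures.prodMap h_beams)),
    ← Measure.map_prod_map _ _ h_arrivals (h_departures.prodMap h_beams),
    ← Measure.map_prod_map _ _ h_departures h_beams, map_restrict_infinitePi,
    map_restrict_infinitePi, map_restrict_infinitePi, Measure.map_id, finiteAnglesLaw]

instance : IsProbabilityMeasure (finiteAnglesLaw c η U) := by
  unfold finiteAnglesLaw
  infer_instance

lemma finiteAnglesLaw_real_singleton (x : FiniteAngles NBS NUE η U) :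
    (finiteAnglesLaw c η U).real {x} = angleWeight c η U x := by
  obtain ⟨i, φ, θ, k⟩ := x
  have h_atom {N : ℕ} (q : PMF (Fin N)) (x : Fin N) : q.toMeasure {x} = q x :=
    PMF.toMeasure_apply_singleton _ _ (measurableSet_singleton x)
  rw [measureReal_def, finiteAnglesLaw, ← Set.singleton_prod_singleton,
    ← Set.singleton_prod_singleton, ← Set.singleton_prod_singleton, Measure.prod_prod,
    Measure.prod_prod, Measure.prod_prod, Measure.pi_singleton, Measure.pi_singleton,
    Measure.pi_singleton]
  simp only [h_atom, ENNReal.toReal_mul, ENNReal.toReal_prod, angleWeight]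

lemma psiIntegrand_eq_restrictAngles (s t : ℝ) (z : Fin NUE × Angles NBS NUE) :
    psiIntegrand c s η U t z =
      ((1 + s * gain c * t⁻¹ / (η * U) * angleGain c η U (restrictAngles η U z)) ^ η)⁻¹ := by
  simp only [psiIntegrand, angleGain, restrictAngles, Prod.map_fst, Prod.map_snd, id,
    Finset.sum_range, chi, mul_pow]

lemma PsiCS_eq_sum (s t : ℝ) : PsiCS c s η U t = ∑ x, angleWeight c η U x *
    ((1 + s * gain c * t⁻¹ / (η * U) * angleGain c η U x) ^ η)⁻¹ := by
  simp_rw [PsiCS_eq, psiIntegrand_eq_restrictAngles]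
  rw [← integral_map (f := fun x : FiniteAngles NBS NUE η U =>
      ((1 + s * gain c * t⁻¹ / (η * U) * angleGain c η U x) ^ η)⁻¹)
    (measurable_restrictAngles η U).aemeasurable (measurable_of_finite _).aestronglyMeasurable,
    map_restrictAngles, integral_fintype Integrable.of_finite]
  simp_rw [finiteAnglesLaw_real_singleton, smul_eq_mul]

end FiniteAngles

section AlignmentCounts

variable {NBS NUE : ℕ} (c : Params NBS NUE) (η U : ℕ)

/-- The summation index of `Psi`: the AOA of the service link, the number of aligned AOAs, the
directions of the `U` beams, and the number of AODs aligned with each of them. -/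
abbrev AlignmentCounts (NBS NUE η U : ℕ) : Type :=
  Fin NUE × Fin (η + 1) × (Fin U → Fin NBS) × (Fin U → Fin (η + 1))

/-- The binomial weight of a term of `Psi`. -/
def alignmentWeight (x : AlignmentCounts NBS NUE η U) : ℝ :=
  (c.qUE x.1).toReal * (binomialWeight η (c.qUE x.1).toReal x.2.1 *
    ∏ n, (c.qBS (x.2.2.1 n)).toReal * binomialWeight η (c.qBS (x.2.2.1 n)).toReal (x.2.2.2 n))

/-- The sum over the beams of the aligned gains, which stands in `Psi` for the sum
`∑_w ∑_j χ_{j,w}²` of `PsiCS`. -/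
def alignmentGain (x : AlignmentCounts NBS NUE η U) : ℝ :=
  ∑ n, alignedGain c.rhoBS c.rhoUE η (x.2.2.2 n) x.2.1

lemma alignmentGain_nonneg (x : AlignmentCounts NBS NUE η U) : 0 ≤ alignmentGain c η U x :=
  Finset.sum_nonneg fun _ _ => alignedGain_nonneg _ _ _ _ _

lemma alignmentWeight_nonneg (x : AlignmentCounts NBS NUE η U) : 0 ≤ alignmentWeight c η U x := by
  have h_weight {N : ℕ} (q : PMF (Fin N)) (i : Fin N) (m : ℕ) :
      0 ≤ binomialWeight η (q i).toReal m :=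
    binomialWeight_nonneg η m ENNReal.toReal_nonneg
      (ENNReal.toReal_le_of_le_ofReal zero_le_one (by simpa using q.coe_le_one i))
  exact mul_nonneg ENNReal.toReal_nonneg (mul_nonneg (h_weight c.qUE _ _)
    (Finset.prod_nonneg fun n _ => mul_nonneg ENNReal.toReal_nonneg (h_weight c.qBS _ _)))

lemma sum_Icc_eq_sum_alignedGain {η U : ℕ} (ρB ρU : ℝ) (m : ℕ) (j : Fin U → ℕ) :
    ∑ r ∈ Finset.Icc 1 η, (∑ n, (ρB ^ 2 + if r ≤ j n then 1 - ρB ^ 2 else 0)) *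
      (ρU ^ 2 + if r ≤ m then 1 - ρU ^ 2 else 0) = ∑ n, alignedGain ρB ρU η (j n) m := by
  simp_rw [alignedGain, Finset.sum_mul]
  exact Finset.sum_comm

lemma Psi_eq_sum (s t : ℝ) : Psi c s η U t = ∑ x, alignmentWeight c η U x *
    ((1 + s * gain c * t⁻¹ / (η * U) * alignmentGain c η U x) ^ η)⁻¹ := by
  simp_rw [Fintype.sum_prod_type, Psi, sum_Icc_eq_sum_alignedGain, Finset.sum_range,
    alignmentWeight, alignmentGain, Finset.mul_sum, mul_binomialWeight, ← mul_assoc,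
    mul_binomialWeight]

variable {s t : ℝ}

lemma Psi_nonneg (hs : 0 ≤ s) (ht : 0 < t) : 0 ≤ Psi c s η U t := by
  rw [Psi_eq_sum]
  refine Finset.sum_nonneg fun x _ => mul_nonneg (alignmentWeight_nonneg c η U x) ?_
  have h_gain := gain_nonneg c
  have h_aligned := alignmentGain_nonneg c η U x
  positivity

lemma sum_alignmentWeight_exp_le {a : ℝ} (ha : 0 ≤ a) :
    ∑ x, alignmentWeight c η U x * Real.exp (-(a * alignmentGain c η U x)) ≤
      ∑ x, angleWeight c η U x * Real.exp (-(a * angleGain c η U x)) := by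
  have h_sum {N : ℕ} (q : PMF (Fin N)) : ∑ i, (q i).toReal = 1 :=
    (hasSum_fintype _).unique (hasSum_pmf_toReal q)
  simp_rw [Fintype.sum_prod_type, alignmentWeight, alignmentGain, angleWeight, angleGain,
    mul_assoc, ← Finset.mul_sum]
  refine Finset.sum_le_sum fun i _ => mul_le_mul_of_nonneg_left ?_ ENNReal.toReal_nonneg
  rw [← Finset.sum_range fun m => binomialWeight η (c.qUE i).toReal m *
    ∑ k : Fin U → Fin NBS, ∑ j : Fin U → Fin (η + 1),
      (∏ n, (c.qBS (k n)).toReal * binomialWeight η (c.qBS (k n)).toReal (j n)) *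
        Real.exp (-(a * ∑ n, alignedGain c.rhoBS c.rhoUE η (j n) m))]
  exact sum_aligned_exp_le (h_sum c.qBS) (fun _ => ENNReal.toReal_nonneg) (h_sum c.qUE)
    (fun _ => ENNReal.toReal_nonneg) (pow_le_one₀ c.rhoBS_nonneg c.rhoBS_lt_one.le)
    (pow_le_one₀ c.rhoUE_nonneg c.rhoUE_lt_one.le) i U ha

lemma Psi_le_PsiCS (hs : 0 ≤ s) (ht : 0 < t) : Psi c s η U t ≤ PsiCS c s η U t := by
  have h_gain := gain_nonneg c
  rw [Psi_eq_sum, PsiCS_eq_sum]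
  exact sum_mul_inv_pow_le η (alignmentGain_nonneg c η U)
    (fun x => Finset.sum_nonneg fun n _ => Finset.sum_nonneg fun r _ => by positivity)
    (fun a ha => sum_alignmentWeight_exp_le c η U ha) (by positivity)

lemma lowerExponent_PsiCS_le (hs : 0 ≤ s) (b : Bool) (l : ℝ) :
    lowerExponent c (PsiCS c s) b l ≤ lowerExponent c (Psi c s) b l :=
  lowerExponent_antitone c b l (fun U _ ht => Psi_nonneg c (c.eta b) U hs ht)
    (fun U _ ht => Psi_le_PsiCS c (c.eta b) U hs ht)
    (fun U _ ht => PsiCS_le_one c (c.eta b) U hs ht)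

end AlignmentCounts

section Equiprobable

variable {NBS NUE : ℕ} (c : Params NBS NUE)

lemma ne_zero_of_pmf_fin {N : ℕ} (q : PMF (Fin N)) : N ≠ 0 := by
  rintro rfl
  exact Fin.elim0 q.support_nonempty.some

lemma sum_prod_mul_const {N U : ℕ} {p : ℝ} (hp : N * p = 1) {ι : Type*} [Fintype ι]
    (w : ι → ℝ) (f : (Fin U → ι) → ℝ) :
    ∑ _k : Fin U → Fin N, ∑ j, (∏ n, p * w (j n)) * f j = ∑ j, (∏ n, w (j n)) * f j := by
  simp_rw [Finset.prod_mul_distrib, Finset.prod_const, mul_assoc, ← Finset.mul_sum]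
  rw [Finset.sum_const, nsmul_eq_mul, ← mul_assoc]
  simp [← mul_pow, mul_comm p, hp]

theorem Psi_eq_PsiUniform (hUE : ∀ i, c.qUE i = (NUE : ℝ≥0∞)⁻¹)
    (hBS : ∀ i, c.qBS i = (NBS : ℝ≥0∞)⁻¹) (s : ℝ) (η U : ℕ) (t : ℝ) :
    Psi c s η U t = PsiUniform c s η U t := by
  have h_inv (N : ℕ) : ((N : ℝ≥0∞)⁻¹).toReal = 1 / (N : ℝ) := by
    rw [ENNReal.toReal_inv, ENNReal.toReal_natCast, one_div]
  have h_weight (q : ℝ) (m : ℕ) : binomialWeight η q m = η.choose m * q ^ m * (1 - q) ^ (η - m) :=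
    rfl
  have hU : (NUE : ℝ) * (1 / NUE) = 1 :=
    mul_one_div_cancel (Nat.cast_ne_zero.2 (ne_zero_of_pmf_fin c.qUE))
  have hB : (NBS : ℝ) * (1 / NBS) = 1 :=
    mul_one_div_cancel (Nat.cast_ne_zero.2 (ne_zero_of_pmf_fin c.qBS))
  simp_rw [Psi, PsiUniform, hUE, hBS, h_inv, ← mul_binomialWeight, ← h_weight]
  rw [Finset.sum_const, Finset.card_univ, Fintype.card_fin, nsmul_eq_mul, Finset.mul_sum]
  refine Finset.sum_congr rfl fun m _ => ?_
  rw [sum_prod_mul_const hB fun j : Fin (η + 1) => binomialWeight η (1 / NBS) j, ← mul_assoc,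
    ← mul_assoc, hU, one_mul]

end Equiprobable

end MmWave

end

theorem mainTheorem9 {NBS NUE : ℕ} (c : MmWave.Params NBS NUE)
    {Ω : Type*} [MeasurableSpace Ω] (P : MeasureTheory.Measure Ω)
    [MeasureTheory.IsProbabilityMeasure P]
    (Φ : Ω → Set (MmWave.Station NBS NUE)) (φ₀ : Ω → Fin NUE)
    (hnet : MmWave.IsNetwork P c Φ φ₀) (s : ℝ) (hs : 0 ≤ s) :
    (∀ᵐ l ∂(P.map fun ω => MmWave.servingLoss c (Φ ω)),
      -- upper bound
      MmWave.condLaplace P c Φ φ₀ s l ≤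
        MmWave.expNeg ((1 - c.pU 0) * MmWave.upperExponent c s l) ∧
      (c.pU 0 = 0 → MmWave.condLaplace P c Φ φ₀ s l ≤
        MmWave.expNeg (MmWave.upperExponent c s l)) ∧
      -- lower bound with the expectation over the angles that Cauchy-Schwarz gives
      MmWave.expNeg (MmWave.lowerExponent c (MmWave.PsiCS c s) true l) *
        MmWave.expNeg (MmWave.lowerExponent c (MmWave.PsiCS c s) false l) ≤
          MmWave.condLaplace P c Φ φ₀ s l ∧
      -- lower bound with the explicit sum
      MmWave.expNeg (MmWave.lowerExponent c (MmWave.Psi c s) true l) *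
        MmWave.expNeg (MmWave.lowerExponent c (MmWave.Psi c s) false l) ≤
          MmWave.condLaplace P c Φ φ₀ s l) ∧
    -- the explicit sum for equiprobable virtual angles
    ((∀ i, c.qUE i = (NUE : ℝ≥0∞)⁻¹) → (∀ i, c.qBS i = (NBS : ℝ≥0∞)⁻¹) →
      ∀ (η U : ℕ) (t : ℝ), MmWave.Psi c s η U t = MmWave.PsiUniform c s η U t) := by
  refine ⟨?_, fun hUE hBS η U t => MmWave.Psi_eq_PsiUniform c hUE hBS s η U t⟩
  filter_upwards [hnet.condLaplace_ae_eq hs] with l hl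
  rw [hl]
  have h_upper := MmWave.sum_laplaceBeyond_le c hs l
  have h_lower := MmWave.le_sum_laplaceBeyond c hs l
  have h_Psi (b : Bool) := MmWave.expNeg_antitone (MmWave.lowerExponent_PsiCS_le c hs b l)
  exact ⟨h_upper, fun h_zero => by simpa [h_zero] using h_upper, h_lower,
    (mul_le_mul' (h_Psi true) (h_Psi false)).trans h_lower⟩
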